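/- Let the 5-regular bipartition function $B_5$ be defined by $$\sum_{n=0}^{\infty}B_5(n)q^n=\frac{(q^5;q^5)_\infty^2}{(q;q)_\infty^2},\qquad (q^a;q^b)_\infty:=\prod_{m=0}^{\infty}\bigl(1-q^{bm+a}\bigr).$$ Then for all integers $n\ge 0$: \begin{align*} B_5(4n+3)&\equiv 0\pmod{10},\\ B_5(5n+2)&\equiv B_5(5n+3)\equiv B_5(5n+4)\equiv 0\pmod{5},\\ B_5(20n+7)&\equiv B_5(20n+19)\equiv 0\pmod{100}. \end{align*} -/

import Mathlib

noncomputable section FiveRegularBipartitions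

open PowerSeries
open scoped PowerSeries.WithPiTopology

/-- The `q`-Pochhammer symbol `(q^a; q^b)_∞ = ∏_{m ≥ 0} (1 - q^(b m + a))`, as a formal power series
in `q = X` with integer coefficients. The infinite product converges coefficientwise whenever
`a, b ≥ 1`, see `multipliable_qPochhammer`. -/
def qPochhammer (a b : ℕ) : PowerSeries ℤ :=
  ∏' m : ℕ, (1 - (X : PowerSeries ℤ) ^ (b * m + a))

/-- The power series `(q^5; q^5)_∞ ^ 2 / (q; q)_∞ ^ 2`. The constant coefficient of `(q; q)_∞` is
`1`, so the quotient exists over the integers, see `fiveRegularBipartitionSeries_mul`. -/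
def fiveRegularBipartitionSeries : PowerSeries ℤ :=
  qPochhammer 5 5 ^ 2 * invOfUnit (qPochhammer 1 1 ^ 2) 1

/-- The 5-regular bipartition function `B₅(n)`, defined by
`∑ B₅(n) q^n = (q^5; q^5)_∞ ^ 2 / (q; q)_∞ ^ 2`. -/
def B5 (n : ℕ) : ℤ := coeff n fiveRegularBipartitionSeries

theorem multipliable_qPochhammer {a b : ℕ} (ha : 0 < a) (hb : 0 < b) :
    Multipliable fun m : ℕ => (1 : PowerSeries ℤ) - X ^ (b * m + a) := by
  simp_rw [sub_eq_add_neg]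
  apply PowerSeries.WithPiTopology.multipliable_one_add_of_tendsto_order_atTop_nhds_top
  refine ENat.tendsto_nhds_top_iff_natCast_lt.mpr fun n => Filter.eventually_atTop.mpr ⟨n, ?_⟩
  intro m hm
  rw [order_neg, order_X_pow]
  norm_cast
  nlinarith

theorem constantCoeff_qPochhammer {a b : ℕ} (ha : 0 < a) (hb : 0 < b) :
    constantCoeff (qPochhammer a b) = 1 := by
  unfold qPochhammer
  rw [(multipliable_qPochhammer ha hb).map_tprod _
    (PowerSeries.WithPiTopology.continuous_constantCoeff ℤ)]
  have h : ∀ m : ℕ, constantCoeff ((1 : PowerSeries ℤ) - X ^ (b * m + a)) = 1 := fun m => by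
    have : b * m + a ≠ 0 := by omega
    rw [map_sub, map_one, map_pow, constantCoeff_X, zero_pow this, sub_zero]
  simp [h]

/-- `fiveRegularBipartitionSeries` really is the quotient of the two series. -/
theorem fiveRegularBipartitionSeries_mul :
    fiveRegularBipartitionSeries * qPochhammer 1 1 ^ 2 = qPochhammer 5 5 ^ 2 := by
  unfold fiveRegularBipartitionSeries
  rw [mul_assoc, invOfUnit_mul _ _ (by simp [constantCoeff_qPochhammer]), mul_one]

/-- The generating series of the 5-regular partitions (no part divisible by `5`) is
`(q^5; q^5)_∞ / (q; q)_∞`. -/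
theorem mk_card_fiveRegular_mul :
    (PowerSeries.mk fun n => ((Nat.Partition.restricted n (¬ 5 ∣ ·)).card : ℤ)) * qPochhammer 1 1
      = qPochhammer 5 5 := by
  have h1 := multipliable_qPochhammer (a := 1) (b := 1) one_pos one_pos
  rw [Nat.Partition.powerSeriesMk_card_restricted_eq_tprod, qPochhammer, qPochhammer,
    ← (Nat.Partition.multipliable_powerSeriesMk_card_restricted ℤ (¬ 5 ∣ ·)).tprod_mul h1]
  refine tprod_eq_tprod_of_ne_one_bij (fun i => 5 * i.val + 4) ?_ ?_ ?_
  · intro a b h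
    exact Subtype.ext (by simpa using h)
  · intro i hi
    by_cases h5 : 5 ∣ i + 1
    · obtain ⟨j, hj⟩ := h5
      refine ⟨⟨j - 1, ?_⟩, by simp only; omega⟩
      rw [Function.mem_mulSupport]
      intro h
      have h' := congrArg (coeff (5 * (j - 1) + 5)) h
      simp [coeff_X_pow, coeff_one] at h'
    · exfalso
      apply hi
      simp only [h5, not_false_eq_true, if_true, one_mul, pow_mul]
      exact PowerSeries.WithPiTopology.tsum_pow_mul_one_sub_of_constantCoeff_eq_zero (by simp)
  · intro i
    have : 5 ∣ 5 * (i : ℕ) + 4 + 1 := by omega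
    simp [this, add_assoc]

/-- `B₅(n)` counts the pairs of 5-regular partitions of total size `n`. -/
theorem B5_eq_card_pairs (n : ℕ) :
    B5 n = ∑ ij ∈ Finset.HasAntidiagonal.antidiagonal n,
      ((Nat.Partition.restricted ij.1 (¬ 5 ∣ ·)).card : ℤ) *
        ((Nat.Partition.restricted ij.2 (¬ 5 ∣ ·)).card : ℤ) := by
  have h : fiveRegularBipartitionSeries =
      (PowerSeries.mk fun n => ((Nat.Partition.restricted n (¬ 5 ∣ ·)).card : ℤ)) ^ 2 := by
    unfold fiveRegularBipartitionSeries
    rw [← mk_card_fiveRegular_mul, mul_pow, mul_assoc,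
      mul_invOfUnit _ _ (by simp [constantCoeff_qPochhammer]), mul_one]
  rw [B5, h, sq, coeff_mul]
  simp

end FiveRegularBipartitions

/-! ### Signed monomials with doubled exponents. -/

open PowerSeries Filter Topology
open scoped PowerSeries.WithPiTopology

/-! Write f_k = (q^k; q^k)_∞, F = f_5²/f_1², φ(q) = ∑ q^(n²) and ψ(q) = ∑ q^(n(2n+1)), both over ℤ.
The Jacobi triple product turns products into theta series; re-indexing ℤ² along sublattices then
turns products of two theta series into dissections.

Modulo 5 and 25: with S = `theta23 5` and T = `theta14 5`, both series in q^5,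
`eulerProduct_mul_five` gives f_1 f_5 = S² - qST - q²T², and ST = f_5 f_25. Multiplying by the
conjugates under q ↦ ζq, ζ^5 = 1, clears the denominator of F = f_5^4/(f_1 f_5)² to a series in q^5.
The numerator splits by residue class of the exponent, and its classes 2, 3, 4 are visibly multiples
of 5. Modulo 25, classes 2 and 4 of F simplify to 5q² f_25² S² and -5q⁴ f_25² T². These last series
have no exponents ≡ 1, respectively ≡ 3, modulo 4 before the shift by q² or q⁴, which gives 25 ∣
B5(n) for n ≡ 7, 19 modulo 20.

Modulo 5 on 4n+3: F ≡ f_1^8, and f_1^8 has no exponent ≡ 3 modulo 4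
(`coeff_eulerProduct_pow_eight`).

Modulo 2 and 4: F f_2 ≡ f_10 modulo 2, so odd coefficients of F are even. Squaring f_1 f_5 ≡ ψ(q²) +
qψ(q^10) (modulo 2) gives a congruence modulo 4, whence the odd part of F is 2q f_2 ψ(q^10). The
dissection of f_2 f_10 leaves f_2 ψ(q^10) without exponents ≡ 1, 3 modulo 5, so 4 ∣ B5(n) for n ≡ 7,
19 modulo 20. -/

/-- The signed monomial `(-1)^k q^(e/2)`. -/
noncomputable def signedMonomial (k e : ℤ) : PowerSeries ℤ :=
  C ((k.negOnePow : ℤˣ) : ℤ) * X ^ (e / 2).toNat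

theorem signedMonomial_zero : signedMonomial 0 0 = 1 := by simp [signedMonomial]

theorem signedMonomial_congr {k k' e e' : ℤ} (hk : Even (k - k')) (he : e = e') :
    signedMonomial k e = signedMonomial k' e' := by
  rw [signedMonomial, signedMonomial, he, Int.negOnePow_eq_iff _ _ |>.2 hk]

theorem signedMonomial_add_one (k e : ℤ) :
    signedMonomial (k + 1) e = -signedMonomial k e := by
  simp [signedMonomial, Int.negOnePow_succ]

theorem signedMonomial_mul {k k' e e' : ℤ} (h : Even e) (h' : Even e') (h0 : 0 ≤ e)
    (h0' : 0 ≤ e') :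
    signedMonomial k e * signedMonomial k' e' = signedMonomial (k + k') (e + e') := by
  have : ((e + e') / 2).toNat = (e / 2).toNat + (e' / 2).toNat := by
    obtain ⟨a, rfl⟩ := h; obtain ⟨b, rfl⟩ := h'; omega
  rw [signedMonomial, signedMonomial, signedMonomial, this, Int.negOnePow_add, pow_add]
  simp only [Units.val_mul, map_mul]
  ring

theorem X_pow_dvd_signedMonomial {d : ℕ} {k e : ℤ} (h : 2 * d ≤ e) :
    (X : PowerSeries ℤ) ^ d ∣ signedMonomial k e :=
  Dvd.dvd.mul_left (pow_dvd_pow _ (by omega)) _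

theorem coeff_signedMonomial_of_ne {n : ℕ} {k e : ℤ} (h : (e / 2).toNat ≠ n) :
    coeff n (signedMonomial k e) = 0 := by
  rw [signedMonomial, coeff_C_mul, coeff_X_pow, if_neg (Ne.symm h), mul_zero]

/-! ### Convergence in the coefficientwise topology. -/

section Limits

/-- Only finitely many coefficients are constrained, each by a continuous map. Closedness carries
congruences from finite sums and products to infinite ones. -/
theorem isClosed_X_pow_dvd_sub (d : ℕ) (a : PowerSeries ℤ) :
    IsClosed {x : PowerSeries ℤ | X ^ d ∣ x - a} := by
  have : {x : PowerSeries ℤ | X ^ d ∣ x - a} =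
      ⋂ m : ℕ, ⋂ _ : m < d, {x | coeff m x = coeff m a} := by
    ext x; simp [X_pow_dvd_iff, sub_eq_zero]
  rw [this]
  exact isClosed_iInter fun m => isClosed_iInter fun _ =>
    isClosed_eq (WithPiTopology.continuous_coeff ℤ m) continuous_const

theorem X_pow_dvd_tsum {ι : Type*} {f : ι → PowerSeries ℤ} {d : ℕ} (h : ∀ i, X ^ d ∣ f i) :
    X ^ d ∣ ∑' i, f i := by
  by_cases hf : Summable f
  · have := (isClosed_X_pow_dvd_sub d 0).mem_of_tendsto hf.hasSum
      (Eventually.of_forall fun s => by simpa using Finset.dvd_sum fun i _ => h i)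
    simpa using this
  · rw [tsum_eq_zero_of_not_summable hf]; exact dvd_zero _

theorem X_pow_dvd_tprod_sub_one {ι : Type*} {f : ι → PowerSeries ℤ} {d : ℕ}
    (hf : Multipliable f) (h : ∀ i, X ^ d ∣ f i - 1) : X ^ d ∣ (∏' i, f i) - 1 := by
  refine (isClosed_X_pow_dvd_sub d 1).mem_of_tendsto hf.hasProd
    (Eventually.of_forall fun s => ?_)
  refine Finset.prod_induction f (fun x => X ^ d ∣ x - 1) ?_ (by simp) fun i _ => h i
  intro a b ha hb
  have : a * b - 1 = (a - 1) * b + (b - 1) := by ring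
  rw [this]
  exact dvd_add (ha.mul_right _) hb

theorem tendsto_of_X_pow_dvd {A : ℕ → PowerSeries ℤ} {L : PowerSeries ℤ}
    (h : ∀ i, X ^ i ∣ A i - L) : Tendsto A atTop (𝓝 L) := by
  rw [WithPiTopology.tendsto_iff_coeff_tendsto]
  refine fun d => tendsto_atTop_of_eventually_const (i₀ := d + 1) fun i hi => ?_
  have := X_pow_dvd_iff.1 (h i) d (by omega)
  rwa [map_sub, sub_eq_zero] at this

/-- A family of power series with only finitely many members outside each power of `(X)`. -/
def TendsToZero {ι : Type*} (f : ι → PowerSeries ℤ) : Prop :=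
  ∀ d : ℕ, {i | ¬ X ^ d ∣ f i}.Finite

theorem TendsToZero.summable {ι : Type*} {f : ι → PowerSeries ℤ} (h : TendsToZero f) :
    Summable f := by
  rw [WithPiTopology.summable_iff_summable_coeff]
  intro d
  refine summable_of_hasFiniteSupport ((h (d + 1)).subset fun i hi => ?_)
  intro hd
  exact hi (X_pow_dvd_iff.1 hd d (by omega))

theorem tendsToZero_of_natAbs_le {f : ℤ → PowerSeries ℤ} (h : ∀ n, X ^ n.natAbs ∣ f n) :
    TendsToZero f := fun d => (Set.finite_Icc (-d : ℤ) d).subset fun n hn => by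
  by_contra hc
  refine hn ((pow_dvd_pow _ ?_).trans (h n))
  simp only [Set.mem_Icc] at hc
  omega

theorem tendsToZero_nat {f : ℕ → PowerSeries ℤ} (h : ∀ n, X ^ n ∣ f n) :
    TendsToZero f := fun d => (Set.finite_Iio d).subset fun n hn => by
  by_contra hc
  exact hn ((pow_dvd_pow _ (by simpa using hc)).trans (h n))

theorem multipliable_one_add_signedMonomial (δ a : ℤ) {b : ℤ} (ha : 0 ≤ a) (hb : 0 < b) :
    Multipliable fun m : ℕ => 1 + signedMonomial δ (2 * (b * m + a)) := by
  apply PowerSeries.WithPiTopology.multipliable_one_add_of_tendsto_order_atTop_nhds_top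
  refine ENat.tendsto_nhds_top_iff_natCast_lt.mpr fun n =>
    Filter.eventually_atTop.mpr ⟨n + 1, ?_⟩
  intro m hm
  refine lt_of_lt_of_le (b := ((n + 1 : ℕ) : ℕ∞)) (by norm_cast; omega) ?_
  refine le_order _ _ fun i hi => X_pow_dvd_iff.1 (X_pow_dvd_signedMonomial ?_) i (by exact_mod_cast hi)
  have : (m : ℤ) ≤ b * m := by nlinarith
  push_cast
  omega

end Limits

/-- The product `∏ (1 + (-1)^δ q^(b m + a))`. -/
noncomputable def signedPochhammer (δ a b : ℤ) : PowerSeries ℤ :=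
  ∏' m : ℕ, (1 + signedMonomial δ (2 * (b * m + a)))

theorem qPochhammer_eq_signedPochhammer (a b : ℕ) :
    qPochhammer a b = signedPochhammer 1 a b := by
  unfold qPochhammer signedPochhammer
  refine tprod_congr fun m => ?_
  have h : ((b : ℤ) * m + a).toNat = b * m + a := by
    rw [← Int.toNat_natCast (b * m + a)]; push_cast; rfl
  simp [signedMonomial, h, sub_eq_add_neg]

/-- The tail `∏_{j > k} (1 - q^(M j))` of `(q^M; q^M)_∞`, and `0` if `k < 0`. -/
noncomputable def pochhammerTail (M k : ℤ) : PowerSeries ℤ :=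
  if k < 0 then 0 else signedPochhammer 1 (M * (k + 1)) M

theorem signedPochhammer_succ (δ : ℤ) {a b : ℤ} (ha : 0 ≤ a) (hb : 0 < b) :
    signedPochhammer δ a b = (1 + signedMonomial δ (2 * a)) * signedPochhammer δ (a + b) b := by
  unfold signedPochhammer
  have h2 := multipliable_one_add_signedMonomial δ (a + b) (by omega) hb
  have e : ∀ m : ℕ, 1 + signedMonomial δ (2 * (b * ((m + 1 : ℕ) : ℤ) + a)) =
      1 + signedMonomial δ (2 * (b * m + (a + b))) := fun m => by
    congr 2; push_cast; ring
  rw [tprod_eq_zero_mul' (by simpa only [e] using h2)]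
  simp only [e]
  simp

theorem pochhammerTail_step {M : ℤ} (hM : 0 < M) (k : ℤ) :
    pochhammerTail M k = (1 - signedMonomial 0 (2 * (M * (k + 1)))) * pochhammerTail M (k + 1) := by
  unfold pochhammerTail
  rcases lt_trichotomy k (-1) with h | rfl | h
  · rw [if_pos (by omega), if_pos (by omega), mul_zero]
  -- At k = -1 the factor is 1 - q^0 = 0, so the value 0 of the tail at negative indices respects
  -- the recursion.
  · simp [signedMonomial_zero]
  · rw [if_neg (by omega), if_neg (by omega), signedPochhammer_succ 1 (by nlinarith) hM,
      show M * (k + 1) + M = M * (k + 1 + 1) by ring, sub_eq_add_neg, ← signedMonomial_add_one]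
    rfl

theorem X_pow_dvd_pochhammerTail_sub_one {M : ℤ} (hM : 0 < M) {k : ℤ} (hk : 0 ≤ k) :
    X ^ k.toNat ∣ pochhammerTail M k - 1 := by
  unfold pochhammerTail
  rw [if_neg (by omega)]
  refine X_pow_dvd_tprod_sub_one (multipliable_one_add_signedMonomial _ _ (by nlinarith) hM)
    fun m => ?_
  rw [add_sub_cancel_left]
  apply X_pow_dvd_signedMonomial
  have : 0 ≤ M * (m : ℤ) := by positivity
  have : k + 1 ≤ M * (k + 1) := by nlinarith
  omega

theorem signedPochhammer_tendsto (δ : ℤ) {a b : ℤ} (ha : 0 ≤ a) (hb : 0 < b) :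
    Tendsto (fun n => ∏ m ∈ Finset.range n, (1 + signedMonomial δ (2 * (b * m + a)))) atTop
      (𝓝 (signedPochhammer δ a b)) :=
  (multipliable_one_add_signedMonomial δ a ha hb).hasProd.tendsto_prod_nat

/-! ### The Jacobi triple product. -/

section JacobiTripleProduct

/-- The series `∑ (-1)^(δ n) q^((r + M i) n + M n (n - 1) / 2) ∏_{j > n} (1 - q^(M j))`. -/
noncomputable def eulerSeries (δ r M : ℤ) (i : ℕ) : PowerSeries ℤ :=
  ∑' n : ℕ, signedMonomial (δ * n) (2 * (r + M * i) * n + M * (n * (n - 1))) * pochhammerTail M n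

theorem even_int_mul_pred (n : ℤ) : Even (n * (n - 1)) := Int.even_mul_pred_self n

theorem nat_mul_pred_nonneg (n : ℕ) : (0 : ℤ) ≤ n * (n - 1) := by
  rcases n with _ | n
  · simp
  · push_cast
    rw [add_sub_cancel_right]
    positivity

theorem eulerSeries_term_dvd (δ : ℤ) {r M : ℤ} (hr : 0 < r) (hM : 0 < M) (i n : ℕ) :
    X ^ n ∣ signedMonomial (δ * n) (2 * (r + M * i) * n + M * (n * (n - 1))) := by
  apply X_pow_dvd_signedMonomial
  have h1 := nat_mul_pred_nonneg n
  have h2 : 0 ≤ M * (i : ℤ) := by positivity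
  have h3 : 0 ≤ M * ((n : ℤ) * (n - 1)) := by positivity
  nlinarith

theorem eulerSeries_summable (δ : ℤ) {r M : ℤ} (hr : 0 < r) (hM : 0 < M) (i : ℕ) :
    Summable fun n : ℕ => signedMonomial (δ * n) (2 * (r + M * i) * n + M * (n * (n - 1))) *
      pochhammerTail M n :=
  (tendsToZero_nat fun n => (eulerSeries_term_dvd δ hr hM i n).mul_right _).summable

/-- Raising i multiplies the n-th term by q^(M n), so the difference of the two series carries the
factor 1 - q^(M n). This factor is absorbed by the tail, and a shift of n returns a monomial times
the series at i + 1. -/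
theorem eulerSeries_step (δ : ℤ) {r M : ℤ} (hr : 0 < r) (hM : 0 < M) (i : ℕ) :
    eulerSeries δ r M i =
      (1 + signedMonomial δ (2 * (M * i + r))) * eulerSeries δ r M (i + 1) := by
  have hMi : 0 ≤ M * (i : ℤ) := by positivity
  have hs := eulerSeries_summable δ hr hM (i + 1)
  rw [add_mul, one_mul]
  conv_rhs => rw [eulerSeries, ← hs.tsum_mul_left]
  have hshift : ∀ n : ℕ, signedMonomial δ (2 * (M * i + r)) *
      (signedMonomial (δ * n) (2 * (r + M * ((i + 1 : ℕ) : ℤ)) * n + M * (n * (n - 1))) *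
        pochhammerTail M n) =
      signedMonomial (δ * ((n + 1 : ℕ) : ℤ))
        (2 * (r + M * i) * ((n + 1 : ℕ) : ℤ) + M * (((n + 1 : ℕ) : ℤ) * (((n + 1 : ℕ) : ℤ) - 1))) *
        ((1 - signedMonomial 0 (2 * (M * ((n + 1 : ℕ) : ℤ)))) *
          pochhammerTail M ((n + 1 : ℕ) : ℤ)) := by
    intro n
    have := pochhammerTail_step hM n
    push_cast
    rw [← this, ← mul_assoc]
    rw [signedMonomial_mul (by simp)
      (Even.add (by simp [mul_assoc]) ((even_int_mul_pred _).mul_left _)) (by positivity)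
      (by have := nat_mul_pred_nonneg n; positivity)]
    congr 1
    exact signedMonomial_congr (by ring_nf; simp) (by ring)
  have hsum' : Summable fun n : ℕ => signedMonomial (δ * n)
      (2 * (r + M * i) * n + M * (n * (n - 1))) *
      ((1 - signedMonomial 0 (2 * (M * n))) * pochhammerTail M n) :=
    (tendsToZero_nat fun n => (eulerSeries_term_dvd δ hr hM i n).mul_right _).summable
  have h2 : ∑' n : ℕ, signedMonomial δ (2 * (M * i + r)) *
      (signedMonomial (δ * n) (2 * (r + M * ((i + 1 : ℕ) : ℤ)) * n + M * (n * (n - 1))) *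
        pochhammerTail M n) = ∑' n : ℕ, signedMonomial (δ * n)
      (2 * (r + M * i) * n + M * (n * (n - 1))) *
      ((1 - signedMonomial 0 (2 * (M * n))) * pochhammerTail M n) := by
    rw [hsum'.tsum_eq_zero_add]
    simp only [hshift]
    simp [signedMonomial_zero]
  rw [h2, ← hs.tsum_add hsum', eulerSeries]
  refine tsum_congr fun n => ?_
  have : signedMonomial (δ * n) (2 * (r + M * ((i + 1 : ℕ) : ℤ)) * n + M * (n * (n - 1))) =
      signedMonomial (δ * n) (2 * (r + M * i) * n + M * (n * (n - 1))) *
        signedMonomial 0 (2 * (M * n)) := by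
    rw [signedMonomial_mul
      (Even.add (by simp [mul_assoc]) ((even_int_mul_pred _).mul_left _)) (by simp)
      (by have := nat_mul_pred_nonneg n; positivity) (by positivity)]
    exact signedMonomial_congr (by simp) (by push_cast; ring)
  rw [this]
  ring

/-- Euler's expansion of an infinite product, with denominators cleared by (q^M; q^M)_∞. Iterate the
recursion: as i grows, only the term n = 0 survives. -/
theorem eulerSeries_zero (δ : ℤ) {r M : ℤ} (hr : 0 < r) (hM : 0 < M) :
    eulerSeries δ r M 0 = signedPochhammer δ r M * pochhammerTail M 0 := by
  have h1 : ∀ i : ℕ, eulerSeries δ r M 0 =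
      (∏ m ∈ Finset.range i, (1 + signedMonomial δ (2 * (M * m + r)))) * eulerSeries δ r M i := by
    intro i
    induction i with
    | zero => simp
    | succ i ih => rw [ih, eulerSeries_step δ hr hM i, Finset.prod_range_succ, mul_assoc]
  have h2 : Tendsto (eulerSeries δ r M) atTop (𝓝 (pochhammerTail M 0)) := by
    refine tendsto_of_X_pow_dvd fun i => ?_
    rw [eulerSeries, (eulerSeries_summable δ hr hM i).tsum_eq_zero_add]
    simp only [Nat.cast_zero, mul_zero, zero_mul, add_zero, signedMonomial_zero, one_mul,
      add_sub_cancel_left]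
    refine X_pow_dvd_tsum fun n => Dvd.dvd.mul_right (X_pow_dvd_signedMonomial ?_) _
    have h3 : (0 : ℤ) ≤ M * (((n + 1 : ℕ) : ℤ) * (((n + 1 : ℕ) : ℤ) - 1)) :=
      mul_nonneg hM.le (nat_mul_pred_nonneg _)
    have h4 : (i : ℤ) ≤ M * i := by nlinarith
    have h5 : r + M * i ≤ (r + M * i) * ((n + 1 : ℕ) : ℤ) := by
      push_cast; nlinarith [mul_nonneg (show (0 : ℤ) ≤ r + M * i by nlinarith) (Nat.cast_nonneg n : (0 : ℤ) ≤ n)]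
    linarith
  refine tendsto_nhds_unique (tendsto_const_nhds (x := eulerSeries δ r M 0) (f := (atTop : Filter ℕ))) ?_
  exact ((signedPochhammer_tendsto δ hr.le hM).mul h2).congr fun i => (h1 i).symm

/-- Twice the exponent of the general term of the theta series. -/
def thetaExponent (r s n : ℤ) : ℤ := (r + s) * n ^ 2 + (r - s) * n

theorem thetaExponent_eq (r s n : ℤ) :
    thetaExponent r s n = r * (n * (n + 1)) + s * (n * (n - 1)) := by
  unfold thetaExponent; ring

theorem even_thetaExponent (r s n : ℤ) : Even (thetaExponent r s n) := by
  rw [thetaExponent_eq]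
  exact ((Int.even_mul_succ_self n).mul_left r).add ((even_int_mul_pred n).mul_left s)

theorem two_natAbs_le_thetaExponent {r s : ℤ} (hr : 0 < r) (hs : 0 < s) (n : ℤ) :
    2 * (n.natAbs : ℤ) ≤ thetaExponent r s n := by
  have h1 : 0 ≤ n * (n + 1) := by
    rcases le_or_gt 0 n with h | h
    · positivity
    · nlinarith
  have h2 : 0 ≤ n * (n - 1) := by
    rcases le_or_gt n 0 with h | h
    · nlinarith
    · nlinarith
  have h3 : n * (n + 1) ≤ r * (n * (n + 1)) := by nlinarith
  have h4 : n * (n - 1) ≤ s * (n * (n - 1)) := by nlinarith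
  have h5 : (n.natAbs : ℤ) ≤ n ^ 2 := by
    have : (n.natAbs : ℤ) ^ 2 = n ^ 2 := Int.natAbs_sq n
    nlinarith [Int.le_self_sq (n.natAbs : ℤ)]
  rw [thetaExponent_eq]
  nlinarith

theorem thetaExponent_nonneg {r s : ℤ} (hr : 0 < r) (hs : 0 < s) (n : ℤ) :
    0 ≤ thetaExponent r s n :=
  le_trans (by positivity) (two_natAbs_le_thetaExponent hr hs n)

/-- The theta series `∑_{n ∈ ℤ} (-1)^(δ n) q^(((r + s) n² + (r - s) n) / 2)`. -/
noncomputable def thetaSeries (δ r s : ℤ) : PowerSeries ℤ :=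
  ∑' n : ℤ, signedMonomial (δ * n) (thetaExponent r s n)

theorem X_pow_dvd_thetaTerm (δ : ℤ) {r s : ℤ} (hr : 0 < r) (hs : 0 < s) (n : ℤ) :
    X ^ n.natAbs ∣ signedMonomial (δ * n) (thetaExponent r s n) :=
  X_pow_dvd_signedMonomial (two_natAbs_le_thetaExponent hr hs n)

/-- The theta series with its terms weighted by tails of `(q^(r + s); q^(r + s))_∞`. -/
noncomputable def partialThetaSeries (δ r s : ℤ) (B : ℕ) : PowerSeries ℤ :=
  ∑' n : ℤ, signedMonomial (δ * n) (thetaExponent r s n) * pochhammerTail (r + s) (n + B)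

theorem partialThetaSeries_summable (δ : ℤ) {r s : ℤ} (hr : 0 < r) (hs : 0 < s)
    (g : ℤ → PowerSeries ℤ) :
    Summable fun n : ℤ => signedMonomial (δ * n) (thetaExponent r s n) * g n :=
  (tendsToZero_of_natAbs_le fun n => (X_pow_dvd_thetaTerm δ hr hs n).mul_right _).summable

/-- Expand tail(n + B + 1) = tail(n + B) + q^((r+s)(n+B+1)) tail(n + B + 1); after n ↦ n + 1, the
second sum is a monomial times the series at B. -/
theorem partialThetaSeries_step (δ : ℤ) {r s : ℤ} (hr : 0 < r) (hs : 0 < s) (B : ℕ) :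
    partialThetaSeries δ r s (B + 1) =
      (1 + signedMonomial δ (2 * ((r + s) * B + s))) * partialThetaSeries δ r s B := by
  have hM : 0 < r + s := by omega
  have hsum := partialThetaSeries_summable δ hr hs fun n => pochhammerTail (r + s) (n + B)
  have hsum2 := partialThetaSeries_summable δ hr hs fun n =>
    signedMonomial 0 (2 * ((r + s) * (n + B + 1))) * pochhammerTail (r + s) (n + B + 1)
  have key : ∑' n : ℤ, signedMonomial δ (2 * ((r + s) * B + s)) *
      (signedMonomial (δ * n) (thetaExponent r s n) * pochhammerTail (r + s) (n + B)) =
      ∑' n : ℤ, signedMonomial (δ * n) (thetaExponent r s n) *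
        (signedMonomial 0 (2 * ((r + s) * (n + B + 1))) *
          pochhammerTail (r + s) (n + B + 1)) := by
    rw [← (Equiv.addRight (1 : ℤ)).tsum_eq]
    refine tsum_congr fun n => ?_
    simp only [Equiv.coe_addRight]
    rw [show n + 1 + (B : ℤ) = n + B + 1 by ring]
    rcases lt_or_ge (n + B + 1) 0 with h | h
    · simp [pochhammerTail, h]
    · rw [← mul_assoc, ← mul_assoc,
        signedMonomial_mul (by simp) (even_thetaExponent _ _ _) (by positivity)
          (thetaExponent_nonneg hr hs _),
        signedMonomial_mul (even_thetaExponent _ _ _) (by simp) (thetaExponent_nonneg hr hs _)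
          (by positivity)]
      congr 1
      refine signedMonomial_congr ⟨δ, by ring⟩ ?_
      unfold thetaExponent
      ring
  rw [add_mul, one_mul]
  conv_rhs => rw [partialThetaSeries, ← hsum.tsum_mul_left]
  rw [key, ← hsum.tsum_add hsum2, partialThetaSeries]
  refine tsum_congr fun n => ?_
  rw [pochhammerTail_step hM (n + B)]
  push_cast
  rw [← add_assoc]
  ring

theorem partialThetaSeries_zero (δ : ℤ) {r s : ℤ} :
    partialThetaSeries δ r s 0 = eulerSeries δ r (r + s) 0 := by
  unfold partialThetaSeries eulerSeries
  have hinj : Function.Injective (fun n : ℕ => (n : ℤ)) := Nat.cast_injective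
  rw [← hinj.tsum_eq]
  · refine tsum_congr fun n => ?_
    congr 1
    · exact signedMonomial_congr (by simp) (by unfold thetaExponent; push_cast; ring)
  · intro n hn
    rcases lt_or_ge n 0 with h | h
    · simp [pochhammerTail, h] at hn
    · exact ⟨n.toNat, by simp [h]⟩

/-- The weighted theta series interpolates: at B = 0 negative n drop out and Euler's expansion
applies; as B → ∞ all weights tend to 1. Each step in B contributes one factor of the product
attached to s. -/
theorem jacobi_triple_product (δ : ℤ) {r s : ℤ} (hr : 0 < r) (hs : 0 < s) :
    thetaSeries δ r s = signedPochhammer 1 (r + s) (r + s) * signedPochhammer δ r (r + s) *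
      signedPochhammer δ s (r + s) := by
  have hM : 0 < r + s := by omega
  have h1 : ∀ B : ℕ, partialThetaSeries δ r s B =
      (∏ m ∈ Finset.range B, (1 + signedMonomial δ (2 * ((r + s) * m + s)))) *
        partialThetaSeries δ r s 0 := by
    intro B
    induction B with
    | zero => simp
    | succ B ih => rw [partialThetaSeries_step δ hr hs B, ih, Finset.prod_range_succ]; ring
  have h2 : Tendsto (partialThetaSeries δ r s) atTop (𝓝 (thetaSeries δ r s)) := by
    refine tendsto_of_X_pow_dvd fun B => ?_
    unfold partialThetaSeries thetaSeries
    have hs1 := partialThetaSeries_summable δ hr hs fun n => pochhammerTail (r + s) (n + B)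
    have hs2 := partialThetaSeries_summable δ hr hs fun _ => 1
    simp only [mul_one] at hs2
    rw [← hs1.tsum_sub hs2]
    refine X_pow_dvd_tsum fun n => ?_
    have hd := X_pow_dvd_thetaTerm δ hr hs n
    rw [← mul_sub_one]
    rcases lt_or_ge (n + B) 0 with h | h
    · exact ((pow_dvd_pow _ (by omega)).trans hd).mul_right _
    · refine (pow_dvd_pow _ ?_).trans
        ((pow_add X n.natAbs (n + B).toNat).dvd.trans
          (mul_dvd_mul hd (X_pow_dvd_pochhammerTail_sub_one hM h)))
      omega
  have h3 := ((signedPochhammer_tendsto δ hs.le hM).mul_const (partialThetaSeries δ r s 0)).congr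
    fun B => (h1 B).symm
  rw [tendsto_nhds_unique h2 h3, partialThetaSeries_zero, eulerSeries_zero δ hr hM]
  simp only [pochhammerTail, lt_irrefl, if_false, zero_add, mul_one]
  ring

end JacobiTripleProduct

/-! ### Signed sums of monomials: products, re-indexing, cancellation. -/

section SignedSeries

/-- The series `∑ (-1)^(p i) q^(E i / 2)`. -/
noncomputable def signedSeries {ι : Type*} (p E : ι → ℤ) : PowerSeries ℤ :=
  ∑' i, signedMonomial (p i) (E i)

/-- Doubled exponents of a summable family of monomials. -/
structure IsExponent {ι : Type*} (E : ι → ℤ) : Prop where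
  even : ∀ i, Even (E i)
  nonneg : ∀ i, 0 ≤ E i
  finite : ∀ d : ℤ, {i | E i ≤ d}.Finite

variable {ι κ : Type*}

theorem IsExponent.summable {E : ι → ℤ} (h : IsExponent E) (p : ι → ℤ) :
    Summable fun i => signedMonomial (p i) (E i) :=
  TendsToZero.summable fun d => (h.finite (2 * d)).subset fun i hi => by
    by_contra hc
    simp only [Set.mem_ofPred_eq, not_le] at hc
    exact hi (X_pow_dvd_signedMonomial hc.le)

theorem IsExponent.comp {E : ι → ℤ} (h : IsExponent E) {σ : κ → ι} (hσ : σ.Injective) :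
    IsExponent fun j => E (σ j) :=
  ⟨fun _ => h.even _, fun _ => h.nonneg _, fun d =>
    Set.Finite.preimage (s := {i | E i ≤ d}) hσ.injOn (h.finite d)⟩

theorem IsExponent.add {E : ι → ℤ} {E' : κ → ℤ} (h : IsExponent E) (h' : IsExponent E') :
    IsExponent fun x : ι × κ => E x.1 + E' x.2 :=
  ⟨fun _ => (h.even _).add (h'.even _), fun _ => add_nonneg (h.nonneg _) (h'.nonneg _),
    fun d => ((h.finite d).prod (h'.finite d)).subset fun x hx => by
      have := h.nonneg x.1
      have := h'.nonneg x.2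
      simp only [Set.mem_ofPred_eq, Set.mem_prod] at hx ⊢
      omega⟩

theorem signedSeries_congr {p p' E E' : ι → ℤ} (hp : ∀ i, Even (p i - p' i))
    (hE : ∀ i, E i = E' i) : signedSeries p E = signedSeries p' E' :=
  tsum_congr fun i => signedMonomial_congr (hp i) (hE i)

theorem signedSeries_mul {p E : ι → ℤ} {p' E' : κ → ℤ} (h : IsExponent E) (h' : IsExponent E') :
    signedSeries p E * signedSeries p' E' =
      signedSeries (fun x : ι × κ => p x.1 + p' x.2) (fun x => E x.1 + E' x.2) := by
  have hs := (h.add h').summable (fun x : ι × κ => p x.1 + p' x.2)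
  have hm : ∀ x : ι × κ, signedMonomial (p x.1 + p' x.2) (E x.1 + E' x.2) =
      signedMonomial (p x.1) (E x.1) * signedMonomial (p' x.2) (E' x.2) := fun x =>
    (signedMonomial_mul (h.even _) (h'.even _) (h.nonneg _) (h'.nonneg _)).symm
  unfold signedSeries
  rw [(h.summable p).tsum_mul_tsum (h'.summable p') (by simpa only [hm] using hs)]
  exact tsum_congr fun x => (hm x).symm

theorem X_pow_mul_signedSeries {p E : ι → ℤ} (h : IsExponent E) (d : ℕ) :
    X ^ d * signedSeries p E = signedSeries p fun i => E i + 2 * d := by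
  unfold signedSeries
  rw [← (h.summable p).tsum_mul_left]
  refine tsum_congr fun i => ?_
  have : (X : PowerSeries ℤ) ^ d = signedMonomial 0 (2 * d) := by simp [signedMonomial]
  rw [this, signedMonomial_mul (by simp) (h.even _) (by positivity) (h.nonneg _), zero_add,
    add_comm]

theorem neg_signedSeries (p E : ι → ℤ) :
    -signedSeries p E = signedSeries (fun i => p i + 1) E := by
  unfold signedSeries
  rw [← tsum_neg]
  exact tsum_congr fun i => (signedMonomial_add_one _ _).symm

theorem signedSeries_comp_equiv (p E : ι → ℤ) (τ : κ ≃ ι) :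
    signedSeries (fun i => p (τ i)) (fun i => E (τ i)) = signedSeries p E :=
  τ.tsum_eq fun i => signedMonomial (p i) (E i)

theorem signedSeries_eq_zero {p E : ι → ℤ} (τ : ι ≃ ι) (hp : ∀ i, Odd (p (τ i) - p i))
    (hE : ∀ i, E (τ i) = E i) : signedSeries p E = 0 := by
  have h : signedSeries p E = -signedSeries p E := by
    conv_lhs => rw [← signedSeries_comp_equiv p E τ]
    rw [neg_signedSeries]
    refine signedSeries_congr (fun i => ?_) hE
    obtain ⟨c, hc⟩ := hp i
    exact ⟨c, by linarith⟩
  ext n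
  have hn := congrArg (coeff n) h
  rw [map_neg] at hn
  rw [map_zero]
  omega

theorem signedSeries_split {c : ℕ} {p E : ι → ℤ} (h : IsExponent E) (σ : Fin c → κ → ι)
    (hσ : Function.Bijective fun x : Fin c × κ => σ x.1 x.2) :
    signedSeries p E = ∑ j, signedSeries (fun i => p (σ j i)) (fun i => E (σ j i)) := by
  have hs : Summable fun x : Fin c × κ => signedMonomial (p (σ x.1 x.2)) (E (σ x.1 x.2)) :=
    (Equiv.ofBijective _ hσ).summable_iff.2 (h.summable p)
  have e : ∑' x : Fin c × κ, signedMonomial (p (σ x.1 x.2)) (E (σ x.1 x.2)) = signedSeries p E :=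
    (Equiv.ofBijective _ hσ).tsum_eq fun i => signedMonomial (p i) (E i)
  rw [← e, Summable.tsum_prod' hs fun j => hs.comp_injective (i := fun i => (j, i))
    fun a b hab => by simpa using hab, tsum_fintype]
  rfl

theorem coeff_signedSeries {p E : ι → ℤ} (h : IsExponent E) (n : ℕ) :
    coeff n (signedSeries p E) = ∑' i, coeff n (signedMonomial (p i) (E i)) :=
  (h.summable p).map_tsum (coeff n) (WithPiTopology.continuous_coeff ℤ n)

theorem coeff_signedSeries_eq_zero {p E : ι → ℤ} (h : IsExponent E) {n : ℕ}
    (hn : ∀ i, E i ≠ 2 * n) : coeff n (signedSeries p E) = 0 := by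
  rw [coeff_signedSeries h, ← tsum_zero (β := ι)]
  refine tsum_congr fun i => coeff_signedMonomial_of_ne fun hc => hn i ?_
  obtain ⟨a, ha⟩ := h.even i
  have := h.nonneg i
  omega

theorem natCast_dvd_iff_coeff {m : ℕ} {A : PowerSeries ℤ} :
    (m : PowerSeries ℤ) ∣ A ↔ ∀ n, (m : ℤ) ∣ coeff n A := by
  have hm : (m : PowerSeries ℤ) = C (m : ℤ) := by simp
  rw [hm]
  constructor
  · rintro ⟨B, rfl⟩ n
    rw [coeff_C_mul]
    exact dvd_mul_right _ _
  · intro h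
    choose b hb using h
    exact ⟨mk b, by ext n; rw [coeff_C_mul, coeff_mk, hb]⟩

theorem isClosed_natCast_dvd (m : ℕ) : IsClosed {x : PowerSeries ℤ | (m : PowerSeries ℤ) ∣ x} := by
  have : {x : PowerSeries ℤ | (m : PowerSeries ℤ) ∣ x} =
      ⋂ n : ℕ, coeff n ⁻¹' {z : ℤ | (m : ℤ) ∣ z} := by
    ext x; simp [natCast_dvd_iff_coeff]
  rw [this]
  exact isClosed_iInter fun n =>
    (isClosed_discrete _).preimage (WithPiTopology.continuous_coeff ℤ n)

theorem natCast_dvd_tsum {m : ℕ} {f : ι → PowerSeries ℤ} (h : ∀ i, (m : PowerSeries ℤ) ∣ f i) :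
    (m : PowerSeries ℤ) ∣ ∑' i, f i := by
  by_cases hf : Summable f
  · exact (isClosed_natCast_dvd m).mem_of_tendsto hf.hasSum
      (Eventually.of_forall fun s => Finset.dvd_sum fun i _ => h i)
  · rw [tsum_eq_zero_of_not_summable hf]; exact dvd_zero _

theorem two_dvd_signedSeries_sub {p p' E : ι → ℤ} (h : IsExponent E) :
    ((2 : ℕ) : PowerSeries ℤ) ∣ signedSeries p E - signedSeries p' E := by
  rw [signedSeries, signedSeries, ← (h.summable p).tsum_sub (h.summable p')]
  refine natCast_dvd_tsum fun i => ?_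
  unfold signedMonomial
  rcases Int.units_eq_one_or (p i).negOnePow with h1 | h1 <;>
    rcases Int.units_eq_one_or (p' i).negOnePow with h2 | h2 <;> simp only [h1, h2]
  · exact ⟨0, by ring⟩
  · exact ⟨X ^ (E i / 2).toNat, by simp; ring⟩
  · exact ⟨-X ^ (E i / 2).toNat, by simp; ring⟩
  · exact ⟨0, by ring⟩

end SignedSeries

/-! ### Product formulas for the theta series. -/

section Products

theorem signedPochhammer_split (δ : ℤ) {a b : ℤ} (ha : 0 ≤ a) (hb : 0 < b) (c : ℕ) [NeZero c] :
    signedPochhammer δ a b = ∏ i : Fin c, signedPochhammer δ (a + b * (i : ℕ)) (b * c) := by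
  have hc : 0 < (c : ℤ) := by exact_mod_cast Nat.pos_of_ne_zero (NeZero.ne c)
  have hi : ∀ i : Fin c, 0 ≤ a + b * ((i : ℕ) : ℤ) := fun i => by positivity
  have hm := multipliable_one_add_signedMonomial δ a ha hb
  have hm' : Multipliable fun x : ℕ × Fin c =>
      1 + signedMonomial δ (2 * (b * c * (x.1 : ℤ) + (a + b * ((x.2 : ℕ) : ℤ)))) := by
    have := (Nat.divModEquiv c).symm.multipliable_iff.2 hm
    refine this.congr fun x => ?_
    simp only [Function.comp, Nat.divModEquiv_symm_apply]
    congr 2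
    push_cast
    ring
  have e : signedPochhammer δ a b = ∏' x : ℕ × Fin c,
      (1 + signedMonomial δ (2 * (b * c * (x.1 : ℤ) + (a + b * ((x.2 : ℕ) : ℤ))))) := by
    unfold signedPochhammer
    rw [← (Nat.divModEquiv c).symm.tprod_eq]
    refine tprod_congr fun x => ?_
    simp only [Nat.divModEquiv_symm_apply]
    congr 2
    push_cast
    ring
  rw [e, Multipliable.tprod_prod' hm' fun _ => Multipliable.of_finite]
  unfold signedPochhammer
  rw [← Multipliable.tprod_finsetProd fun i _ =>
    multipliable_one_add_signedMonomial δ _ (hi i) (by positivity)]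
  exact tprod_congr fun m => tprod_fintype _

theorem signedPochhammer_zero_mul_one {a b : ℤ} (ha : 0 ≤ a) (hb : 0 < b) :
    signedPochhammer 0 a b * signedPochhammer 1 a b = signedPochhammer 1 (2 * a) (2 * b) := by
  unfold signedPochhammer
  rw [← (multipliable_one_add_signedMonomial 0 a ha hb).tprod_mul
    (multipliable_one_add_signedMonomial 1 a ha hb)]
  refine tprod_congr fun m => ?_
  have h1 : ∀ e, signedMonomial 1 e = -signedMonomial 0 e := fun e => signedMonomial_add_one 0 e
  have h2 : signedMonomial 0 (2 * (2 * b * m + 2 * a)) =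
      signedMonomial 0 (2 * (b * m + a)) * signedMonomial 0 (2 * (b * m + a)) := by
    rw [signedMonomial_mul (by simp) (by simp) (by positivity) (by positivity)]
    exact signedMonomial_congr (by simp) (by ring)
  rw [h1, h1, h2]
  ring

/-- `(q^k; q^k)_∞`. -/
noncomputable def eulerProduct (k : ℕ) : PowerSeries ℤ := qPochhammer k k

/-- `∑ (-1)^(δ n) q^(k n²)`. -/
noncomputable def phiSeries (δ : ℤ) (k : ℕ) : PowerSeries ℤ := thetaSeries δ k k

/-- `∑ q^(k n (2 n + 1))`. -/
noncomputable def psiSeries (k : ℕ) : PowerSeries ℤ := thetaSeries 0 (3 * k) k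

/-- `∑ (-1)^n q^(k (5 n² + n) / 2)`. -/
noncomputable def theta23 (k : ℕ) : PowerSeries ℤ := thetaSeries 1 (3 * k) (2 * k)

/-- `∑ (-1)^n q^(k (5 n² + 3 n) / 2)`. -/
noncomputable def theta14 (k : ℕ) : PowerSeries ℤ := thetaSeries 1 (4 * k) k

theorem eulerProduct_eq (k : ℕ) : eulerProduct k = signedPochhammer 1 k k :=
  qPochhammer_eq_signedPochhammer k k

variable {k : ℕ}

theorem eulerProduct_eq_odd_mul (hk : 0 < k) :
    eulerProduct k = signedPochhammer 1 k (2 * k) * eulerProduct (2 * k) := by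
  have hk' : 0 < (k : ℤ) := by exact_mod_cast hk
  rw [eulerProduct_eq, eulerProduct_eq, signedPochhammer_split 1 hk'.le hk' 2,
    Fin.prod_univ_two]
  congr 2 <;> simp <;> ring

theorem eulerProduct_sq (hk : 0 < k) :
    eulerProduct k ^ 2 = eulerProduct (2 * k) * phiSeries 1 k := by
  have hk' : 0 < (k : ℤ) := by exact_mod_cast hk
  rw [eulerProduct_eq_odd_mul hk, phiSeries, jacobi_triple_product 1 hk' hk', eulerProduct_eq]
  push_cast
  rw [← two_mul]
  ring

/-- Gauss's product for ψ. For k = 1 the triple product reads ψ = (-q; q²)_∞ (q⁴; q⁴)_∞, and (q;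
q²)_∞ (-q; q²)_∞ = (q²; q⁴)_∞. -/
theorem eulerProduct_mul_psiSeries (hk : 0 < k) :
    eulerProduct k * psiSeries k = eulerProduct (2 * k) ^ 2 := by
  have hk' : 0 < (k : ℤ) := by exact_mod_cast hk
  have h4 : eulerProduct (2 * k) =
      signedPochhammer 1 (2 * k) (4 * k) * signedPochhammer 1 (4 * k) (4 * k) := by
    rw [eulerProduct_eq_odd_mul (by omega), eulerProduct_eq]
    push_cast
    rw [show (2 * (2 * k) : ℤ) = 4 * k by ring]
  have h0 : signedPochhammer 0 k (2 * k) =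
      signedPochhammer 0 k (4 * k) * signedPochhammer 0 (3 * k) (4 * k) := by
    rw [signedPochhammer_split 0 (by positivity) (by positivity) 2, Fin.prod_univ_two]
    congr 2 <;> simp <;> ring
  have h1 := signedPochhammer_zero_mul_one (a := k) (b := 2 * k) (by positivity) (by positivity)
  rw [show (2 * (2 * k) : ℤ) = 4 * k by ring] at h1
  rw [eulerProduct_eq_odd_mul hk, psiSeries, jacobi_triple_product 0 (by positivity) hk',
    show (3 * k + k : ℤ) = 4 * k by ring]
  rw [h0] at h1
  linear_combination (eulerProduct (2 * k)) * signedPochhammer 1 (4 * k) (4 * k) * h1 -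
    eulerProduct (2 * k) * h4

/-- The two triple products supply the residues 3, 2 and 4, 1 modulo 5 and two copies of f_{5k}; one
copy is the missing residue 0 of f_k. -/
theorem theta23_mul_theta14 (hk : 0 < k) :
    theta23 k * theta14 k = eulerProduct k * eulerProduct (5 * k) := by
  have hk' : 0 < (k : ℤ) := by exact_mod_cast hk
  rw [theta23, theta14, jacobi_triple_product 1 (by positivity) (by positivity),
    jacobi_triple_product 1 (by positivity) hk', eulerProduct_eq, eulerProduct_eq,
    signedPochhammer_split 1 (a := k) (by positivity) hk' 5]
  simp only [Fin.prod_univ_five]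
  push_cast
  simp only [Fin.val_zero, Fin.val_one, Fin.val_two]
  rw [show (3 * k + 2 * k : ℤ) = 5 * k by ring, show (4 * k + k : ℤ) = 5 * k by ring,
    show (k * 5 : ℤ) = 5 * k by ring]
  rw [show (k + k * ((0 : ℕ) : ℤ) : ℤ) = k by simp,
    show (k + k * ((1 : ℕ) : ℤ) : ℤ) = 2 * k by push_cast; ring,
    show (k + k * ((2 : ℕ) : ℤ) : ℤ) = 3 * k by push_cast; ring,
    show (k + k * (((3 : Fin 5) : ℕ) : ℤ) : ℤ) = 4 * k by
      rw [show ((3 : Fin 5) : ℕ) = 3 from rfl]; push_cast; ring,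
    show (k + k * (((4 : Fin 5) : ℕ) : ℤ) : ℤ) = 5 * k by
      rw [show ((4 : Fin 5) : ℕ) = 4 from rfl]; push_cast; ring]
  ring

end Products

/-! ### Dissections from sublattices of ℤ². -/

section Lattice

theorem isExponent_of_natAbs_le {E : ℤ → ℤ} (heven : ∀ n, Even (E n)) (h0 : ∀ n, 0 ≤ E n)
    (h : ∀ n, (n.natAbs : ℤ) ≤ E n + 1) : IsExponent E :=
  ⟨heven, h0, fun d => (Set.finite_Icc (-(d + 1)) (d + 1)).subset fun n hn => by
    have := h n
    simp only [Set.mem_ofPred_eq] at hn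
    simp only [Set.mem_Icc]
    omega⟩

theorem isExponent_thetaExponent {r s : ℤ} (hr : 0 < r) (hs : 0 < s) :
    IsExponent (thetaExponent r s) :=
  isExponent_of_natAbs_le (even_thetaExponent r s) (thetaExponent_nonneg hr hs) fun n => by
    have := two_natAbs_le_thetaExponent hr hs n
    omega

theorem thetaSeries_mul {δ δ' r s r' s' : ℤ} (hr : 0 < r) (hs : 0 < s) (hr' : 0 < r')
    (hs' : 0 < s') :
    thetaSeries δ r s * thetaSeries δ' r' s' = signedSeries
      (fun x : ℤ × ℤ => δ * x.1 + δ' * x.2)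
      (fun x => thetaExponent r s x.1 + thetaExponent r' s' x.2) :=
  signedSeries_mul (isExponent_thetaExponent hr hs) (isExponent_thetaExponent hr' hs')

/-- The five cosets in the decomposition of `ℤ²` by the sublattice of index `5`. -/
def latticeFive : Fin 5 → ℤ × ℤ → ℤ × ℤ :=
  ![fun x => (2 * x.1 - x.2, x.1 + 2 * x.2),
    fun x => (-2 * x.1 - x.2 - 1, -x.1 + 2 * x.2),
    fun x => (2 * x.1 - x.2, x.1 + 2 * x.2 + 1),
    fun x => (-2 * x.1 + x.2, -x.1 - 2 * x.2 - 1),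
    fun x => (2 * x.1 - x.2, x.1 + 2 * x.2 + 2)]

/-- The coset of (m, n) is 2n - m modulo 5. Cosets 1 and 3 are reflected to make the linear terms of
the exponents match the target theta series. -/
theorem latticeFive_bijective :
    Function.Bijective fun x : Fin 5 × (ℤ × ℤ) => latticeFive x.1 x.2 := by
  constructor
  · rintro ⟨i, a, b⟩ ⟨j, c, d⟩ h
    fin_cases i <;> fin_cases j <;> simp [latticeFive] at h ⊢ <;> omega
  · rintro ⟨m, n⟩
    have h : (2 * n - m) % 5 = 0 ∨ (2 * n - m) % 5 = 1 ∨ (2 * n - m) % 5 = 2 ∨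
      (2 * n - m) % 5 = 3 ∨ (2 * n - m) % 5 = 4 := by omega
    rcases h with h | h | h | h | h
    · exact ⟨(0, (2 * m + n) / 5, (2 * n - m) / 5), by simp [latticeFive]; omega⟩
    · exact ⟨(1, -((2 * m + n) / 5) - 1, (2 * n - m) / 5), by simp [latticeFive]; omega⟩
    · exact ⟨(2, (2 * m + n) / 5, (2 * n - m) / 5), by simp [latticeFive]; omega⟩
    · exact ⟨(3, -((2 * m + n) / 5) - 1, -((2 * n - m) / 5) - 1),
        by simp [latticeFive]; omega⟩
    · exact ⟨(4, (2 * m + n) / 5, (2 * n - m) / 5), by simp [latticeFive]; omega⟩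

/-- The two cosets in the decomposition of `ℤ²` by parity of the coordinate sum. -/
def latticeTwo : Fin 2 → ℤ × ℤ → ℤ × ℤ :=
  ![fun x => (x.1 + x.2, x.1 - x.2), fun x => (x.1 + x.2 + 1, x.1 - x.2)]

theorem latticeTwo_bijective :
    Function.Bijective fun x : Fin 2 × (ℤ × ℤ) => latticeTwo x.1 x.2 := by
  constructor
  · rintro ⟨i, a, b⟩ ⟨j, c, d⟩ h
    fin_cases i <;> fin_cases j <;> simp [latticeTwo] at h ⊢ <;> omega
  · rintro ⟨m, n⟩
    rcases (by omega : (m + n) % 2 = 0 ∨ (m + n) % 2 = 1) with h | h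
    · exact ⟨(0, (m + n) / 2, (m - n) / 2), by simp [latticeTwo]; omega⟩
    · exact ⟨(1, (m + n - 1) / 2, (m - n - 1) / 2), by simp [latticeTwo]; omega⟩

theorem signedSeries_parity_split {p E : ℤ × ℤ → ℤ} (h : IsExponent E) :
    signedSeries p E =
      signedSeries (fun x : ℤ × ℤ => p (x.1 + x.2, x.1 - x.2))
        (fun x => E (x.1 + x.2, x.1 - x.2)) +
      signedSeries (fun x : ℤ × ℤ => p (x.1 + x.2 + 1, x.1 - x.2))
        (fun x => E (x.1 + x.2 + 1, x.1 - x.2)) := by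
  rw [signedSeries_split h latticeTwo latticeTwo_bijective, Fin.sum_univ_two]
  rfl

/-- The involution `n ↦ -1 - n` on the first coordinate. -/
def reflectFst : ℤ × ℤ ≃ ℤ × ℤ := (Equiv.subLeft (-1)).prodCongr (Equiv.refl ℤ)

/-- The involution `n ↦ -1 - n` on the second coordinate. -/
def reflectSnd : ℤ × ℤ ≃ ℤ × ℤ := (Equiv.refl ℤ).prodCongr (Equiv.subLeft (-1))

/-- Expand f_k f_{5k} as `theta23 k * theta14 k`. On the index 5 sublattice m² + n² = 5(a² + b²), so
each coset is again a product of two theta series: cosets 0, 3, 1 give the three terms in order. -/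
theorem eulerProduct_mul_five {k : ℕ} (hk : 0 < k) :
    eulerProduct k * eulerProduct (5 * k) = theta23 (5 * k) ^ 2 -
      X ^ k * (theta23 (5 * k) * theta14 (5 * k)) - X ^ (2 * k) * theta14 (5 * k) ^ 2 := by
  have hk' : 0 < (k : ℤ) := by exact_mod_cast hk
  have h23 := isExponent_thetaExponent (r := 3 * k) (s := 2 * k) (by positivity) (by positivity)
  have h14 := isExponent_thetaExponent (r := 4 * k) (s := k) (by positivity) hk'
  have i23 := isExponent_thetaExponent (r := 3 * (5 * k)) (s := 2 * (5 * k)) (by positivity)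
    (by positivity)
  have i14 := isExponent_thetaExponent (r := 4 * (5 * k)) (s := 5 * k) (by positivity)
    (by positivity)
  rw [← theta23_mul_theta14 hk, theta23, theta14, theta23, theta14]
  push_cast
  rw [sq, sq, thetaSeries_mul (by positivity) (by positivity) (by positivity) hk',
    thetaSeries_mul (by positivity) (by positivity) (by positivity) (by positivity),
    thetaSeries_mul (by positivity) (by positivity) (by positivity) (by positivity),
    thetaSeries_mul (by positivity) (by positivity) (by positivity) (by positivity),
    X_pow_mul_signedSeries (i23.add i14), X_pow_mul_signedSeries (i14.add i14),
    sub_eq_add_neg, sub_eq_add_neg, neg_signedSeries, neg_signedSeries,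
    signedSeries_split (h23.add h14) latticeFive latticeFive_bijective, Fin.sum_univ_five]
  -- Cosets 2 and 4 vanish: a reflection of one coordinate fixes the exponent and flips the sign.
  have z2 : signedSeries (fun x => 1 * (latticeFive 2 x).1 + 1 * (latticeFive 2 x).2)
      (fun x => thetaExponent (3 * k) (2 * k) (latticeFive 2 x).1 +
        thetaExponent (4 * k) k (latticeFive 2 x).2) = 0 := by
    refine signedSeries_eq_zero reflectSnd ?_ ?_ <;> rintro ⟨a, b⟩
    · simp only [reflectSnd, latticeFive, Int.odd_iff]
      simp
      omega
    · simp [reflectSnd, latticeFive, thetaExponent]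
      ring
  have z4 : signedSeries (fun x => 1 * (latticeFive 4 x).1 + 1 * (latticeFive 4 x).2)
      (fun x => thetaExponent (3 * k) (2 * k) (latticeFive 4 x).1 +
        thetaExponent (4 * k) k (latticeFive 4 x).2) = 0 := by
    refine signedSeries_eq_zero reflectFst ?_ ?_ <;> rintro ⟨a, b⟩
    · simp only [reflectFst, latticeFive, Int.odd_iff]
      simp
      omega
    · simp [reflectFst, latticeFive, thetaExponent]
      ring
  rw [z2, z4, add_zero, add_zero, add_right_comm]
  refine congrArg₂ _ (congrArg₂ _ ?_ ?_) ?_ <;> refine signedSeries_congr ?_ ?_ <;>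
    rintro ⟨a, b⟩ <;> simp only [latticeFive, thetaExponent, Int.even_iff] <;> simp <;>
    first | omega | ring

theorem phiSeries_zero_mul_one {k : ℕ} (hk : 0 < k) :
    phiSeries 0 k * phiSeries 1 k = phiSeries 1 (2 * k) ^ 2 := by
  have hk' : 0 < (k : ℤ) := by exact_mod_cast hk
  have h := isExponent_thetaExponent hk' hk'
  rw [sq, phiSeries, phiSeries, phiSeries]
  push_cast
  rw [thetaSeries_mul hk' hk' hk' hk',
    thetaSeries_mul (by positivity) (by positivity) (by positivity) (by positivity),
    signedSeries_parity_split (h.add h)]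
  rw [signedSeries_eq_zero (p := fun x : ℤ × ℤ => 0 * (x.1 + x.2 + 1) + 1 * (x.1 - x.2)) reflectFst]
  · rw [add_zero]
    refine signedSeries_congr ?_ ?_ <;> rintro ⟨a, b⟩
    · simp only [Int.even_iff]; omega
    · simp only [thetaExponent]; ring
  · rintro ⟨a, b⟩
    simp only [reflectFst, Int.odd_iff]
    simp
    omega
  · rintro ⟨a, b⟩
    simp [reflectFst, thetaExponent]
    ring

theorem isExponent_thetaSq_left {r s : ℤ} (hr : 0 < r) (hs : 0 < s) :
    IsExponent fun n : ℤ => 2 * (r + s) * n ^ 2 + 2 * (r - s) * n := by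
  have h := isExponent_thetaExponent hr hs
  have := (h.add h).comp (σ := fun n : ℤ => (n, n)) fun a b hab => by simpa using hab
  convert this using 2 with n
  unfold thetaExponent
  ring

theorem isExponent_thetaSq_right {r s : ℤ} (hr : 0 < r) (hs : 0 < s) :
    IsExponent fun n : ℤ => 2 * (r + s) * n ^ 2 + 4 * r * n + 2 * r := by
  have h := isExponent_thetaExponent hr hs
  have := (h.add h).comp (σ := fun n : ℤ => (n + 1, n)) fun a b hab => by simpa using hab
  convert this using 2 with n
  unfold thetaExponent
  ring

theorem isExponent_oblong {c : ℤ} (hc : 0 < c) :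
    IsExponent fun n : ℤ => c * (n * (n + 1)) := by
  have h0 : ∀ n : ℤ, 0 ≤ n * (n + 1) := fun n => by
    rcases le_or_gt 0 n with h | h
    · positivity
    · nlinarith
  refine isExponent_of_natAbs_le (fun n => (Int.even_mul_succ_self n).mul_left c) (fun n => ?_)
    (fun n => ?_)
  · have := h0 n
    positivity
  · have h1 := h0 n
    have h2 : n * (n + 1) ≤ c * (n * (n + 1)) := by nlinarith
    have h3 : (n.natAbs : ℤ) ^ 2 = n ^ 2 := Int.natAbs_sq n
    have h4 : -(n.natAbs : ℤ) ≤ n := by omega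
    have h5 : (n.natAbs : ℤ) - 1 ≤ n * (n + 1) := by nlinarith [sq_nonneg ((n.natAbs : ℤ) - 1)]
    linarith

theorem signedSeries_oblong {c : ℕ} (hc : 0 < c) :
    signedSeries (fun _ => 0) (fun n : ℤ => (c : ℤ) * (n * (n + 1))) = 2 * psiSeries c := by
  have hc' : 0 < (c : ℤ) := by exact_mod_cast hc
  have hb : Function.Bijective fun x : Fin 2 × ℤ =>
      (![fun n => 2 * n, fun n => -2 * n - 1] : Fin 2 → ℤ → ℤ) x.1 x.2 := by
    constructor
    · rintro ⟨i, a⟩ ⟨j, b⟩ h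
      fin_cases i <;> fin_cases j <;> simp at h ⊢ <;> omega
    · intro n
      rcases (by omega : n % 2 = 0 ∨ n % 2 = 1) with h | h
      · exact ⟨(0, n / 2), by simp; omega⟩
      · exact ⟨(1, -(n + 1) / 2), by simp; omega⟩
  rw [signedSeries_split (isExponent_oblong hc') _ hb, Fin.sum_univ_two,
    two_mul (psiSeries c)]
  refine congrArg₂ _ ?_ ?_ <;> refine signedSeries_congr (fun n => by simp) (fun n => ?_) <;>
    simp [thetaExponent] <;> ring

/-- With (m, n) = (x + y, x - y) or (x + y + 1, x - y), the sign (-1)^(m+n) is constant on each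
coset. The odd coset carries ∑ q^(c y(y+1)) = 2ψ(q^(2c)), hence is even. -/
theorem thetaSeries_one_sq {r s : ℤ} {c : ℕ} (hr : 0 < r) (hs : 0 < s) (hc : r + s = c) :
    thetaSeries 1 r s ^ 2 =
      signedSeries (fun _ => 0) (fun n : ℤ => 2 * (r + s) * n ^ 2 + 2 * (r - s) * n) *
        phiSeries 0 c -
      signedSeries (fun _ => 0) (fun n : ℤ => 2 * (r + s) * n ^ 2 + 4 * r * n + 2 * r) *
        (2 * psiSeries (2 * c)) := by
  have hc' : 0 < (c : ℤ) := by omega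
  have h := isExponent_thetaExponent hr hs
  have h2c : 0 < (((2 * c : ℕ) : ℕ) : ℤ) := by push_cast; omega
  rw [sq, thetaSeries_mul hr hs hr hs, signedSeries_parity_split (h.add h),
    ← signedSeries_oblong (by omega), phiSeries]
  rw [show thetaSeries 0 (c : ℤ) (c : ℤ) =
    signedSeries (fun n => 0 * n) (thetaExponent (c : ℤ) (c : ℤ)) from rfl]
  rw [signedSeries_mul (isExponent_thetaSq_left hr hs) (isExponent_thetaExponent hc' hc'),
    sub_eq_add_neg,
    signedSeries_mul (isExponent_thetaSq_right hr hs) (isExponent_oblong h2c), neg_signedSeries]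
  refine congrArg₂ _ ?_ ?_ <;> refine signedSeries_congr ?_ ?_ <;> rintro ⟨a, b⟩
  · simp only [Int.even_iff]; omega
  · simp only [thetaExponent, ← hc]; ring
  · simp only [Int.even_iff]; omega
  · push_cast
    simp only [thetaExponent, ← hc]; ring

end Lattice

/-! ### Exponents and divisibility in residue classes. -/

section Support

/-- All exponents occurring in `A` are congruent to `r` modulo `m`. -/
def SupportedMod (m r : ℕ) (A : PowerSeries ℤ) : Prop :=
  ∀ n, n % m ≠ r % m → coeff n A = 0

/-- The coefficients of `A` at exponents congruent to `r` modulo `m` are divisible by `d`. -/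
def DvdAtMod (d : ℤ) (m r : ℕ) (A : PowerSeries ℤ) : Prop :=
  ∀ n, n % m = r % m → d ∣ coeff n A

variable {m r r' : ℕ} {d : ℤ} {A B U : PowerSeries ℤ}

theorem SupportedMod.mul (hA : SupportedMod m r A) (hB : SupportedMod m r' B) :
    SupportedMod m (r + r') (A * B) := by
  intro n hn
  rw [coeff_mul]
  refine Finset.sum_eq_zero fun x hx => ?_
  by_cases h1 : x.1 % m = r % m
  · by_cases h2 : x.2 % m = r' % m
    · exfalso
      rw [← Finset.HasAntidiagonal.mem_antidiagonal.1 hx, Nat.add_mod, h1, h2, ← Nat.add_mod] at hn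
      exact hn rfl
    · rw [hB _ h2, mul_zero]
  · rw [hA _ h1, zero_mul]

theorem SupportedMod.congr (hA : SupportedMod m r A) (h : r % m = r' % m) :
    SupportedMod m r' A := by
  intro n hn
  exact hA n (by rwa [h])

theorem SupportedMod.add (hA : SupportedMod m r A) (hB : SupportedMod m r B) :
    SupportedMod m r (A + B) := fun n hn => by rw [map_add, hA n hn, hB n hn, add_zero]

theorem SupportedMod.sub (hA : SupportedMod m r A) (hB : SupportedMod m r B) :
    SupportedMod m r (A - B) := fun n hn => by rw [map_sub, hA n hn, hB n hn, sub_zero]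

theorem supportedMod_X_pow (m k : ℕ) : SupportedMod m k (X ^ k) := by
  intro n hn
  rw [coeff_X_pow, if_neg]
  rintro rfl
  exact hn rfl

theorem supportedMod_one (m : ℕ) : SupportedMod m 0 1 := by
  simpa using supportedMod_X_pow m 0

theorem SupportedMod.intCast_mul (hA : SupportedMod m r A) (z : ℤ) :
    SupportedMod m r ((z : PowerSeries ℤ) * A) := fun n hn => by
  have : (z : PowerSeries ℤ) = C z := by simp
  rw [this, coeff_C_mul, hA n hn, mul_zero]

theorem SupportedMod.pow (hA : SupportedMod m 0 A) (k : ℕ) : SupportedMod m 0 (A ^ k) := by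
  induction k with
  | zero => simpa using supportedMod_one m
  | succ k ih => rw [pow_succ]; exact ih.mul hA

theorem SupportedMod.dvdAtMod {m' : ℕ} (hA : SupportedMod m r A) (hm : m ∣ m')
    (h : r' % m ≠ r % m) : DvdAtMod d m' r' A := fun n hn => by
  rw [hA n]
  · exact dvd_zero _
  · have := congrArg (· % m) hn
    simp only [Nat.mod_mod_of_dvd _ hm] at this
    rwa [this]

theorem DvdAtMod.add (hA : DvdAtMod d m r A) (hB : DvdAtMod d m r B) : DvdAtMod d m r (A + B) :=
  fun n hn => by rw [map_add]; exact dvd_add (hA n hn) (hB n hn)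

theorem DvdAtMod.sub (hA : DvdAtMod d m r A) (hB : DvdAtMod d m r B) : DvdAtMod d m r (A - B) :=
  fun n hn => by rw [map_sub]; exact dvd_sub (hA n hn) (hB n hn)

theorem dvdAtMod_of_dvd {d : ℕ} (h : (d : PowerSeries ℤ) ∣ A) : DvdAtMod d m r A :=
  fun n _ => natCast_dvd_iff_coeff.1 h n

theorem DvdAtMod.mul_supportedMod (hA : DvdAtMod d m r A) (hU : SupportedMod m 0 U) :
    DvdAtMod d m r (A * U) := by
  intro n hn
  rw [coeff_mul]
  refine Finset.dvd_sum fun x hx => ?_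
  by_cases h2 : x.2 % m = 0 % m
  · refine (hA _ ?_).mul_right _
    rw [← hn, ← Finset.HasAntidiagonal.mem_antidiagonal.1 hx, Nat.add_mod, h2, ← Nat.add_mod, add_zero]
  · rw [hU _ h2, mul_zero]
    exact dvd_zero _

/-- Cancels a series in q^m with constant term 1: such a factor does not mix residue classes, so
coefficients are recovered by induction inside the class. The case d = 0 is a vanishing statement.
-/
theorem DvdAtMod.of_mul (h : DvdAtMod d m r (A * U)) (hU : SupportedMod m 0 U)
    (h1 : constantCoeff U = 1) : DvdAtMod d m r A := by
  intro n
  induction n using Nat.strong_induction_on with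
  | _ n ih =>
    intro hn
    have hc := h n hn
    rw [coeff_mul, ← Finset.add_sum_erase _ _ (Finset.HasAntidiagonal.mem_antidiagonal.2
      (show (n, 0).1 + (n, 0).2 = n from add_zero n))] at hc
    simp only [coeff_zero_eq_constantCoeff, h1, mul_one] at hc
    refine (dvd_add_left (Finset.dvd_sum fun x hx => ?_)).1 hc
    obtain ⟨hx1, hx2⟩ := Finset.mem_erase.1 hx
    have hx3 := Finset.HasAntidiagonal.mem_antidiagonal.1 hx2
    by_cases h2 : x.2 % m = 0 % m
    · refine (ih x.1 ?_ ?_).mul_right _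
      · rcases Nat.eq_zero_or_pos x.2 with h0 | h0
        · exact absurd (Prod.ext (by simpa [h0] using hx3) h0) hx1
        · omega
      · rw [← hn, ← hx3, Nat.add_mod x.1, h2, ← Nat.add_mod, add_zero]
    · rw [hU _ h2, mul_zero]
      exact dvd_zero _

theorem natCast_dvd_of_mul {d : ℕ} (h : (d : PowerSeries ℤ) ∣ A * U) (h1 : constantCoeff U = 1) :
    (d : PowerSeries ℤ) ∣ A :=
  natCast_dvd_iff_coeff.2 fun n => (dvdAtMod_of_dvd (m := 1) (r := 0) h).of_mul
    (fun n hn => absurd (by omega) hn) h1 n (by omega)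

theorem supportedMod_thetaSeries {m : ℕ} (δ : ℤ) {r s : ℤ} (hr : 0 < r) (hs : 0 < s)
    (hmr : (m : ℤ) ∣ r) (hms : (m : ℤ) ∣ s) : SupportedMod m 0 (thetaSeries δ r s) := by
  intro n hn
  refine coeff_signedSeries_eq_zero (isExponent_thetaExponent hr hs) fun i hi => hn ?_
  rw [Nat.zero_mod, ← Nat.dvd_iff_mod_eq_zero]
  rw [thetaExponent_eq] at hi
  obtain ⟨a, ha⟩ := Int.even_mul_succ_self i
  obtain ⟨b, hb⟩ := even_int_mul_pred i
  have : (n : ℤ) = r * a + s * b := by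
    rw [ha, hb] at hi
    linarith
  exact_mod_cast this ▸ dvd_add (hmr.mul_right a) (hms.mul_right b)

theorem supportedMod_eulerProduct {m k : ℕ} (hk : 0 < k) (h : m ∣ k) :
    SupportedMod m 0 (eulerProduct k) := by
  have hc : IsClosed {x : PowerSeries ℤ | SupportedMod m 0 x} := by
    have : {x : PowerSeries ℤ | SupportedMod m 0 x} =
        ⋂ n : ℕ, ⋂ _ : n % m ≠ 0 % m, {x | coeff n x = 0} := by
      ext x; simp [SupportedMod]
    rw [this]
    exact isClosed_iInter fun n => isClosed_iInter fun _ =>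
      isClosed_eq (WithPiTopology.continuous_coeff ℤ n) continuous_const
  refine hc.mem_of_tendsto (multipliable_qPochhammer hk hk).hasProd (Eventually.of_forall fun s =>
    Finset.prod_induction _ (SupportedMod m 0) (fun _ _ ha hb => ha.mul hb) (supportedMod_one m)
      fun i _ => (supportedMod_one m).sub ((supportedMod_X_pow m _).congr ?_))
  rw [Nat.zero_mod, ← Nat.dvd_iff_mod_eq_zero]
  exact dvd_add (h.mul_right _) h

theorem constantCoeff_eulerProduct {k : ℕ} (hk : 0 < k) : constantCoeff (eulerProduct k) = 1 :=
  constantCoeff_qPochhammer hk hk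

end Support

/-! ### Frobenius congruences for Euler products. -/

section Frobenius

theorem natCast_dvd_tprod_sub {ι : Type*} {m : ℕ} {f g : ι → PowerSeries ℤ}
    (hf : Multipliable f) (hg : Multipliable g) (h : ∀ i, (m : PowerSeries ℤ) ∣ f i - g i) :
    (m : PowerSeries ℤ) ∣ ∏' i, f i - ∏' i, g i := by
  refine (isClosed_natCast_dvd m).mem_of_tendsto (hf.hasProd.sub hg.hasProd)
    (Eventually.of_forall fun s => ?_)
  classical
  induction s using Finset.induction_on with
  | empty => simp
  | insert a s ha ih =>
    simp only [Set.mem_ofPred_eq] at ih ⊢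
    rw [Finset.prod_insert ha, Finset.prod_insert ha]
    obtain ⟨u, hu⟩ := h a
    obtain ⟨v, hv⟩ := ih
    exact ⟨u * ∏ i ∈ s, f i + g a * v, by linear_combination (∏ i ∈ s, f i) * hu + g a * hv⟩

theorem natCast_dvd_eulerProduct_pow_sub {p k : ℕ} (hp : 0 < p) (hk : 0 < k)
    (h : ∀ Y : PowerSeries ℤ, (p : PowerSeries ℤ) ∣ (1 - Y) ^ p - (1 - Y ^ p)) :
    (p : PowerSeries ℤ) ∣ eulerProduct k ^ p - eulerProduct (p * k) := by
  have hm := multipliable_qPochhammer hk hk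
  rw [eulerProduct, eulerProduct, qPochhammer, qPochhammer, ← hm.tprod_pow]
  refine natCast_dvd_tprod_sub (hm.pow p) (multipliable_qPochhammer (by positivity)
    (by positivity)) fun i => ?_
  have : (X : PowerSeries ℤ) ^ (p * k * i + p * k) = (X ^ (k * i + k)) ^ p := by
    rw [← pow_mul]; congr 1; ring
  rw [this]
  exact h _

theorem two_dvd_eulerProduct_sq_sub {k : ℕ} (hk : 0 < k) :
    ((2 : ℕ) : PowerSeries ℤ) ∣ eulerProduct k ^ 2 - eulerProduct (2 * k) :=
  natCast_dvd_eulerProduct_pow_sub two_pos hk fun Y => ⟨Y ^ 2 - Y, by push_cast; ring⟩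

theorem five_dvd_eulerProduct_pow_sub {k : ℕ} (hk : 0 < k) :
    ((5 : ℕ) : PowerSeries ℤ) ∣ eulerProduct k ^ 5 - eulerProduct (5 * k) :=
  natCast_dvd_eulerProduct_pow_sub (by norm_num) hk fun Y =>
    ⟨-Y + 2 * Y ^ 2 - 2 * Y ^ 3 + Y ^ 4, by push_cast; ring⟩

end Frobenius

/-! ### Theta series modulo 2 and the quintisection of ψ. -/

section ThetaCongruences

theorem two_dvd_phiSeries_zero_sub_one {k : ℕ} (hk : 0 < k) :
    ((2 : ℕ) : PowerSeries ℤ) ∣ phiSeries 0 k - 1 := by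
  have hk' : 0 < (k : ℤ) := by exact_mod_cast hk
  have h1 : ((2 : ℕ) : PowerSeries ℤ) ∣ phiSeries 0 k - phiSeries 1 k :=
    two_dvd_signedSeries_sub (isExponent_thetaExponent hk' hk')
  have h2 : ((2 : ℕ) : PowerSeries ℤ) ∣ phiSeries 1 k - 1 := by
    refine natCast_dvd_of_mul (U := eulerProduct (2 * k)) ?_
      (constantCoeff_eulerProduct (by omega))
    have := two_dvd_eulerProduct_sq_sub hk
    rw [eulerProduct_sq hk] at this
    convert this using 1
    ring
  have := dvd_add h1 h2
  rwa [sub_add_sub_cancel] at this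

/-- The reduction modulo `2` of the square of `∑ (-1)^n q^(((r + s) n² + (r - s) n) / 2)`. -/
noncomputable def thetaDouble (r s : ℤ) : PowerSeries ℤ :=
  signedSeries (fun _ => 0) (fun n : ℤ => 2 * (r + s) * n ^ 2 + 2 * (r - s) * n)

theorem two_dvd_thetaSeries_one_sq_sub {r s : ℤ} (hr : 0 < r) (hs : 0 < s) :
    ((2 : ℕ) : PowerSeries ℤ) ∣ thetaSeries 1 r s ^ 2 - thetaDouble r s := by
  obtain ⟨c, hc⟩ := Int.eq_ofNat_of_zero_le (show 0 ≤ r + s by omega)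
  obtain ⟨Y, hY⟩ := two_dvd_phiSeries_zero_sub_one (k := c) (by omega)
  rw [thetaSeries_one_sq hr hs hc, ← thetaDouble]
  push_cast at hY ⊢
  exact ⟨thetaDouble r s * Y - signedSeries (fun _ => 0)
    (fun n : ℤ => 2 * (r + s) * n ^ 2 + 4 * r * n + 2 * r) * psiSeries (2 * c),
    by linear_combination (thetaDouble r s) * hY⟩

/-- The integers congruent to `0, 2, 1, 3, 4` modulo `5`, the second and last class reflected. -/
def intFive : Fin 5 → ℤ → ℤ :=
  ![fun n => 5 * n, fun n => -5 * n - 3, fun n => 5 * n + 1, fun n => 5 * n + 3,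
    fun n => -5 * n - 1]

theorem intFive_bijective : Function.Bijective fun x : Fin 5 × ℤ => intFive x.1 x.2 := by
  constructor
  · rintro ⟨i, a⟩ ⟨j, b⟩ h
    fin_cases i <;> fin_cases j <;> simp [intFive] at h ⊢ <;> omega
  · intro n
    have h : n % 5 = 0 ∨ n % 5 = 1 ∨ n % 5 = 2 ∨ n % 5 = 3 ∨ n % 5 = 4 := by omega
    rcases h with h | h | h | h | h
    · exact ⟨(0, n / 5), by simp [intFive]; omega⟩
    · exact ⟨(2, n / 5), by simp [intFive]; omega⟩
    · exact ⟨(1, -(n + 3) / 5), by simp [intFive]; omega⟩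
    · exact ⟨(3, n / 5), by simp [intFive]; omega⟩
    · exact ⟨(4, -(n + 1) / 5), by simp [intFive]; omega⟩

/-- The even and the odd integers. -/
def intTwo : Fin 2 → ℤ → ℤ := ![fun n => 2 * n, fun n => 2 * n + 1]

theorem intTwo_injective (i : Fin 2) : Function.Injective (intTwo i) := by
  intro a b h
  fin_cases i <;> simp [intTwo] at h <;> omega

theorem intTwo_bijective : Function.Bijective fun x : Fin 2 × ℤ =>
    intTwo x.1 x.2 := by
  constructor
  · rintro ⟨i, a⟩ ⟨j, b⟩ h
    fin_cases i <;> fin_cases j <;> simp [intTwo] at h ⊢ <;> omega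
  · intro n
    rcases (by omega : n % 2 = 0 ∨ n % 2 = 1) with h | h
    · exact ⟨(0, n / 2), by simp [intTwo]; omega⟩
    · exact ⟨(1, n / 2), by simp [intTwo]; omega⟩

/-- Split n modulo 5. Classes 0 and 2 are the even and odd terms of the first theta series, classes
4 and 3 those of the second, and class 1 reproduces ψ. -/
theorem psiSeries_quintisection {k : ℕ} (hk : 0 < k) :
    psiSeries (2 * k) = thetaDouble (15 * k) (10 * k) +
      X ^ (2 * k) * thetaDouble (20 * k) (5 * k) + X ^ (6 * k) * psiSeries (50 * k) := by
  have hk' : 0 < (k : ℤ) := by exact_mod_cast hk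
  have e1 := isExponent_thetaSq_left (r := 15 * k) (s := 10 * k) (by positivity) (by positivity)
  have e2 := isExponent_thetaSq_left (r := 20 * k) (s := 5 * k) (by positivity) (by positivity)
  have e3 := isExponent_thetaExponent (r := 3 * (2 * k)) (s := 2 * k) (by positivity)
    (by positivity)
  have e4 := isExponent_thetaExponent (r := 3 * (50 * k)) (s := 50 * k) (by positivity)
    (by positivity)
  rw [psiSeries, psiSeries]
  push_cast
  rw [thetaDouble, thetaDouble, thetaSeries, thetaSeries, ← signedSeries, ← signedSeries,
    signedSeries_split e1 intTwo intTwo_bijective, Fin.sum_univ_two,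
    signedSeries_split e2 intTwo intTwo_bijective, Fin.sum_univ_two,
    signedSeries_split e3 intFive intFive_bijective, Fin.sum_univ_five, mul_add (X ^ (2 * k)),
    X_pow_mul_signedSeries (e2.comp (intTwo_injective 0)),
    X_pow_mul_signedSeries (e2.comp (intTwo_injective 1)),
    X_pow_mul_signedSeries e4]
  have comm : ∀ a b c d e : PowerSeries ℤ, a + b + c + d + e = (a + b) + (e + d) + c :=
    fun a b c d e => by ring
  rw [comm]
  refine congrArg₂ _ (congrArg₂ _ (congrArg₂ _ ?_ ?_) (congrArg₂ _ ?_ ?_)) ?_ <;>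
    refine signedSeries_congr (fun n => by simp) (fun n => ?_) <;>
    simp [intFive, intTwo, thetaExponent] <;> ring

end ThetaCongruences

/-! ### The quintic norm and the 5-dissection of the generating series. -/

section Progressions

theorem fiveRegularBipartitionSeries_mul_eulerProduct :
    fiveRegularBipartitionSeries * eulerProduct 1 ^ 2 = eulerProduct 5 ^ 2 :=
  fiveRegularBipartitionSeries_mul

theorem eulerProduct_one_mul_five : eulerProduct 1 * eulerProduct 5 =
    theta23 5 ^ 2 - X * (theta23 5 * theta14 5) - X ^ 2 * theta14 5 ^ 2 := by
  simpa using eulerProduct_mul_five (k := 1) one_pos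

/-- The norm of `s² - q s t - q² t²` over the fifth roots of unity. -/
noncomputable def quinticNorm (s t : PowerSeries ℤ) : PowerSeries ℤ :=
  s ^ 10 - 11 * X ^ 5 * s ^ 5 * t ^ 5 - X ^ 10 * t ^ 10

/-- The five components of the square of the cofactor of `s² - q s t - q² t²` in its norm,
by residue of the exponent of `q`. -/
noncomputable def quinticComponent (s t : PowerSeries ℤ) : ℕ → PowerSeries ℤ
  | 0 => s ^ 16 + 16 * X ^ 5 * s ^ 11 * t ^ 5 + 27 * X ^ 10 * s ^ 6 * t ^ 10 -
      2 * X ^ 15 * s * t ^ 15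
  | 1 => 2 * s ^ 15 * t + 27 * X ^ 5 * s ^ 10 * t ^ 6 - 16 * X ^ 10 * s ^ 5 * t ^ 11 +
      X ^ 15 * t ^ 16
  | 2 => 5 * s ^ 14 * t ^ 2 + 20 * X ^ 5 * s ^ 9 * t ^ 7 + 20 * X ^ 10 * s ^ 4 * t ^ 12
  | 3 => 10 * s ^ 13 * t ^ 3 + 15 * X ^ 5 * s ^ 8 * t ^ 8 - 10 * X ^ 10 * s ^ 3 * t ^ 13
  | 4 => 20 * s ^ 12 * t ^ 4 - 20 * X ^ 5 * s ^ 7 * t ^ 9 + 5 * X ^ 10 * s ^ 2 * t ^ 14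
  | _ => 0

/-- Here N = f1 f5 C, with C the product of the other four conjugates; thus F N² = f5⁴ C², and C² is
sorted by powers of q modulo 5. -/
theorem mul_quinticNorm_sq {F f1 f5 s t : PowerSeries ℤ} (hF : F * f1 ^ 2 = f5 ^ 2)
    (hD : f1 * f5 = s ^ 2 - X * (s * t) - X ^ 2 * t ^ 2) :
    F * quinticNorm s t ^ 2 =
      ∑ i ∈ Finset.range 5, f5 ^ 4 * (X ^ i * quinticComponent s t i) := by
  have hN : quinticNorm s t = (f1 * f5) * (s ^ 8 + X * s ^ 7 * t + 2 * X ^ 2 * s ^ 6 * t ^ 2 +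
      3 * X ^ 3 * s ^ 5 * t ^ 3 + 5 * X ^ 4 * s ^ 4 * t ^ 4 - 3 * X ^ 5 * s ^ 3 * t ^ 5 +
      2 * X ^ 6 * s ^ 2 * t ^ 6 - X ^ 7 * s * t ^ 7 + X ^ 8 * t ^ 8) := by
    rw [hD, quinticNorm]
    ring
  rw [hN]
  simp only [Finset.sum_range_succ, Finset.sum_range_zero, quinticComponent]
  linear_combination (f5 ^ 2 * (s ^ 8 + X * s ^ 7 * t + 2 * X ^ 2 * s ^ 6 * t ^ 2 +
      3 * X ^ 3 * s ^ 5 * t ^ 3 + 5 * X ^ 4 * s ^ 4 * t ^ 4 - 3 * X ^ 5 * s ^ 3 * t ^ 5 +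
      2 * X ^ 6 * s ^ 2 * t ^ 6 - X ^ 7 * s * t ^ 7 + X ^ 8 * t ^ 8) ^ 2) * hF

/-- Modulo 5 all conjugates coincide, so the norm is (f1 f5)^5, and f1^5 ≡ f5. -/
theorem five_dvd_quinticNorm_sub {f1 f5 s t : PowerSeries ℤ}
    (hD : f1 * f5 = s ^ 2 - X * (s * t) - X ^ 2 * t ^ 2)
    (h5 : ((5 : ℕ) : PowerSeries ℤ) ∣ f1 ^ 5 - f5) :
    ((5 : ℕ) : PowerSeries ℤ) ∣ quinticNorm s t - f5 ^ 6 := by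
  obtain ⟨V, hV⟩ := h5
  have h : ((5 : ℕ) : PowerSeries ℤ) ∣ quinticNorm s t - (f1 * f5) ^ 5 := by
    rw [hD, quinticNorm]
    refine ⟨X * s ^ 9 * t - X ^ 2 * s ^ 8 * t ^ 2 - 2 * X ^ 3 * s ^ 7 * t ^ 3 +
      3 * X ^ 4 * s ^ 6 * t ^ 4 - 3 * X ^ 6 * s ^ 4 * t ^ 6 -
      2 * X ^ 7 * s ^ 3 * t ^ 7 + X ^ 8 * s ^ 2 * t ^ 8 + X ^ 9 * s * t ^ 9, ?_⟩
    push_cast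
    ring
  obtain ⟨W, hW⟩ := h
  exact ⟨W + f5 ^ 5 * V, by linear_combination hW + f5 ^ 5 * hV⟩

theorem supportedMod_theta23 {k : ℕ} (hk : 0 < k) {m : ℕ} (h : m ∣ k) :
    SupportedMod m 0 (theta23 k) :=
  supportedMod_thetaSeries 1 (by positivity) (by positivity)
    ((Int.natCast_dvd_natCast.2 h).mul_left _) ((Int.natCast_dvd_natCast.2 h).mul_left _)

theorem supportedMod_theta14 {k : ℕ} (hk : 0 < k) {m : ℕ} (h : m ∣ k) :
    SupportedMod m 0 (theta14 k) :=
  supportedMod_thetaSeries 1 (by positivity) (by positivity)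
    ((Int.natCast_dvd_natCast.2 h).mul_left _) (Int.natCast_dvd_natCast.2 h)

theorem supportedMod_quinticNorm {s t : PowerSeries ℤ} (hs : SupportedMod 5 0 s)
    (ht : SupportedMod 5 0 t) : SupportedMod 5 0 (quinticNorm s t) := by
  have hX : ∀ k, SupportedMod 5 0 ((X : PowerSeries ℤ) ^ (5 * k)) := fun k =>
    (supportedMod_X_pow 5 (5 * k)).congr (by simp)
  have h11 := (((hX 1).mul (hs.pow 5)).mul (ht.pow 5)).intCast_mul 11
  have := ((hs.pow 10).sub h11).sub ((hX 2).mul (ht.pow 10))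
  convert this using 1
  rw [quinticNorm]
  push_cast
  ring

theorem supportedMod_quinticComponent {s t : PowerSeries ℤ} (hs : SupportedMod 5 0 s)
    (ht : SupportedMod 5 0 t) (i : ℕ) : SupportedMod 5 0 (quinticComponent s t i) := by
  have hX : ∀ (z : ℤ) (k i j : ℕ),
      SupportedMod 5 0 ((z : PowerSeries ℤ) * (X ^ (5 * k) * s ^ i * t ^ j)) := fun z k i j =>
    (((((supportedMod_X_pow 5 (5 * k)).congr (by simp)).mul (hs.pow i)).mul
      (ht.pow j)).intCast_mul z)
  match i with
  | 0 =>
    convert (((hX 1 0 16 0).add (hX 16 1 11 5)).add (hX 27 2 6 10)).sub (hX 2 3 1 15) using 1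
    simp only [quinticComponent]; push_cast; ring
  | 1 =>
    convert (((hX 2 0 15 1).add (hX 27 1 10 6)).sub (hX 16 2 5 11)).add (hX 1 3 0 16) using 1
    simp only [quinticComponent]; push_cast; ring
  | 2 =>
    convert ((hX 5 0 14 2).add (hX 20 1 9 7)).add (hX 20 2 4 12) using 1
    simp only [quinticComponent]; push_cast; ring
  | 3 =>
    convert ((hX 10 0 13 3).add (hX 15 1 8 8)).sub (hX 10 2 3 13) using 1
    simp only [quinticComponent]; push_cast; ring
  | 4 =>
    convert ((hX 20 0 12 4).sub (hX 20 1 7 9)).add (hX 5 2 2 14) using 1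
    simp only [quinticComponent]; push_cast; ring
  | n + 5 => exact fun _ _ => map_zero _

theorem constantCoeff_quinticNorm_theta :
    constantCoeff (quinticNorm (theta23 5) (theta14 5)) = 1 := by
  have h := congrArg constantCoeff eulerProduct_one_mul_five
  simp [constantCoeff_eulerProduct] at h
  -- The dissection determines only the square of the constant term of `theta23 5`, which suffices
  -- for a tenth power.
  have h10 : constantCoeff (theta23 5) ^ 10 = (constantCoeff (theta23 5) ^ 2) ^ 5 := by ring
  simp [quinticNorm, h10, ← h]

theorem SupportedMod.dvdAtMod_X_pow_mul {m r' : ℕ} {d : ℤ} {G U : PowerSeries ℤ} {r : ℕ}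
    (hG : SupportedMod m 0 G) (hU : SupportedMod m 0 U) (h : r' % m ≠ r % m) :
    DvdAtMod d m r' (U * (X ^ r * G)) :=
  (hU.mul ((supportedMod_X_pow m r).mul hG)).dvdAtMod dvd_rfl (by simpa using h)

end Progressions

/-! ### Vanishing coefficients modulo 4. -/

section Vanishing

/-- Write f_25² = f_50 φ(-q^25) and expand the theta square. The first term contains φ(q^25)φ(-q^25)
= φ(-q^50)², so it is even in q. In the second, f_50 ψ(q^50) = f_100² is a series in q⁴, and `hA`
excludes the class c from what remains. -/
theorem coeff_eulerProduct_sq_mul_thetaSeries_sq {r s : ℤ} (hr : 0 < r) (hs : 0 < s)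
    (hrs : r + s = 25) {c : ℕ} (hc : c % 2 = 1)
    (hA : ∀ k l : ℤ, (25 * k ^ 2 + 2 * r * k + r + 25 * l ^ 2) % 4 ≠ (c : ℤ) % 4) :
    DvdAtMod 0 4 c (eulerProduct 25 ^ 2 * thetaSeries 1 r s ^ 2) := by
  have hL := isExponent_thetaSq_left hr hs
  have hR := isExponent_thetaSq_right hr hs
  have hphi := isExponent_thetaExponent (r := 25) (s := 25) (by norm_num) (by norm_num)
  have h1 : SupportedMod 2 0 (thetaDouble r s) := by
    intro n hn
    refine coeff_signedSeries_eq_zero hL fun i hi => hn ?_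
    obtain ⟨a, ha⟩ := Int.even_mul_succ_self i
    have : (n : ℤ) = 2 * (25 * a + (r - 25) * i) := by
      have : (n : ℤ) = 25 * (i * (i + 1)) + 2 * (r - 25) * i := by
        have hs' : s = 25 - r := by omega
        subst hs'
        linarith
      rw [this, ha]
      ring
    omega
  have h2 : DvdAtMod 0 4 c (signedSeries (fun _ => 0)
      (fun n : ℤ => 2 * (r + s) * n ^ 2 + 4 * r * n + 2 * r) * phiSeries 1 25) := by
    intro n hn
    rw [phiSeries, show thetaSeries 1 ((25 : ℕ) : ℤ) ((25 : ℕ) : ℤ) =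
      signedSeries (fun n => 1 * n) (thetaExponent 25 25) from rfl, signedSeries_mul hR hphi,
      coeff_signedSeries_eq_zero (hR.add hphi)]
    rintro ⟨k, l⟩ hkl
    apply hA k l
    have : (n : ℤ) = 25 * k ^ 2 + 2 * r * k + r + 25 * l ^ 2 := by
      simp only [thetaExponent, hrs] at hkl
      linarith
    rw [← this]
    omega
  have hphi50 : SupportedMod 2 0 (phiSeries 1 50) :=
    supportedMod_thetaSeries 1 (by norm_num) (by norm_num) (by norm_num) (by norm_num)
  have h3 : SupportedMod 2 0 (eulerProduct 50 * thetaDouble r s * phiSeries 1 50 ^ 2) :=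
    ((supportedMod_eulerProduct (by norm_num) (by norm_num)).mul h1).mul (hphi50.pow 2)
  have h4 := h2.mul_supportedMod
    (((supportedMod_eulerProduct (k := 100) (by norm_num) (by norm_num)).pow 2).intCast_mul 2)
  have h5 := (h3.dvdAtMod (m' := 4) (r' := c) (d := 0) (by norm_num) (by omega)).sub h4
  convert h5 using 1
  have e1 := eulerProduct_sq (k := 25) (by norm_num)
  have e2 := eulerProduct_mul_psiSeries (k := 50) (by norm_num)
  have e3 := phiSeries_zero_mul_one (k := 25) (by norm_num)
  norm_num at e1 e2 e3
  rw [thetaSeries_one_sq hr hs (c := 25) (by exact_mod_cast hrs), ← thetaDouble, e1, ← e2, ← e3]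
  push_cast
  ring

theorem coeff_eulerProduct_sq_mul_theta23_sq :
    DvdAtMod 0 4 1 (eulerProduct 25 ^ 2 * theta23 5 ^ 2) := by
  refine coeff_eulerProduct_sq_mul_thetaSeries_sq (by norm_num) (by norm_num) (by norm_num)
    (by norm_num) fun k l => ?_
  -- Here r = 15 and the form is (k + 1)² + l² + 2 modulo 4, never 1.
  obtain ⟨a, rfl | rfl⟩ := Int.even_or_odd' k <;> obtain ⟨b, rfl | rfl⟩ := Int.even_or_odd' l <;>
    push_cast <;> ring_nf <;> omega

theorem coeff_eulerProduct_sq_mul_theta14_sq :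
    DvdAtMod 0 4 3 (eulerProduct 25 ^ 2 * theta14 5 ^ 2) := by
  refine coeff_eulerProduct_sq_mul_thetaSeries_sq (by norm_num) (by norm_num) (by norm_num)
    (by norm_num) fun k l => ?_
  -- Here r = 20 and the form is k² + l² modulo 4, never 3.
  obtain ⟨a, rfl | rfl⟩ := Int.even_or_odd' k <;> obtain ⟨b, rfl | rfl⟩ := Int.even_or_odd' l <;>
    push_cast <;> ring_nf <;> omega

theorem phiSeries_one_sq : ∃ O, phiSeries 1 1 ^ 2 = phiSeries 0 2 ^ 2 + O ∧
    SupportedMod 4 1 O := by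
  have h := isExponent_thetaExponent (r := 1) (s := 1) one_pos one_pos
  refine ⟨signedSeries (fun x : ℤ × ℤ => 1 * (x.1 + x.2 + 1) + 1 * (x.1 - x.2)) (fun x : ℤ × ℤ =>
    thetaExponent 1 1 (x.1 + x.2 + 1) + thetaExponent 1 1 (x.1 - x.2)), ?_, ?_⟩
  · rw [sq, sq, phiSeries, phiSeries]
    push_cast
    rw [thetaSeries_mul one_pos one_pos one_pos one_pos,
      thetaSeries_mul two_pos two_pos two_pos two_pos, signedSeries_parity_split (h.add h)]
    congr 1
    refine signedSeries_congr ?_ ?_ <;> rintro ⟨a, b⟩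
    · simp only [Int.even_iff]; omega
    · simp only [thetaExponent]; ring
  · intro n hn
    have hinj : Function.Injective fun x : ℤ × ℤ => (x.1 + x.2 + 1, x.1 - x.2) := by
      rintro ⟨a, b⟩ ⟨c, d⟩ h
      simp at h ⊢
      omega
    refine coeff_signedSeries_eq_zero ((h.add h).comp hinj) ?_
    rintro ⟨a, b⟩ hab
    apply hn
    obtain ⟨a', ha⟩ := Int.even_mul_succ_self a
    obtain ⟨b', hb⟩ := Int.even_mul_succ_self b
    have : (n : ℤ) = 2 * (a * (a + 1)) + 2 * (b * (b + 1)) + 1 := by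
      simp only [thetaExponent] at hab
      linarith
    rw [ha, hb] at this
    omega

/-- f_1^8 = f_2⁴ (φ(q²)² + O)². The terms φ(q²)⁴ and O² give even exponents; the cross term is 2O
times (f_2² φ(q²))² = (f_4 φ(-q⁴)²)², a series in q⁴, so its exponents are ≡ 1. -/
theorem coeff_eulerProduct_pow_eight : DvdAtMod 0 4 3 (eulerProduct 1 ^ 8) := by
  obtain ⟨O, hO, hs⟩ := phiSeries_one_sq
  have e1 := eulerProduct_sq (k := 1) (by norm_num)
  have e2 := eulerProduct_sq (k := 2) (by norm_num)
  have e3 := phiSeries_zero_mul_one (k := 2) (by norm_num)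
  norm_num at e1 e2 e3
  have hp2 : SupportedMod 2 0 (phiSeries 0 2) :=
    supportedMod_thetaSeries 0 (by norm_num) (by norm_num) (by norm_num) (by norm_num)
  have hp4 : SupportedMod 4 0 (phiSeries 1 4) :=
    supportedMod_thetaSeries 1 (by norm_num) (by norm_num) (by norm_num) (by norm_num)
  have hs2 : SupportedMod 2 1 O := fun n hn => hs n (by omega)
  have h0 : SupportedMod 2 0 (eulerProduct 2 ^ 4 * (phiSeries 0 2 ^ 4 + O * O)) :=
    ((supportedMod_eulerProduct (by norm_num) (by norm_num)).pow 4).mul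
      ((hp2.pow 4).add ((hs2.mul hs2).congr (by norm_num)))
  have h1 : SupportedMod 4 (1 + 0) (O * ((2 : ℤ) * (eulerProduct 4 * phiSeries 1 4 ^ 2) ^ 2)) :=
    hs.mul (((((supportedMod_eulerProduct (by norm_num) (by norm_num)).mul
      (hp4.pow 2)).pow 2)).intCast_mul 2)
  have h := (h0.dvdAtMod (m' := 4) (r' := 3) (d := 0) (by norm_num) (by norm_num)).add
    (h1.dvdAtMod (m' := 4) (r' := 3) (d := 0) dvd_rfl (by norm_num))
  convert h using 1
  have e4 : eulerProduct 4 * phiSeries 1 4 ^ 2 = eulerProduct 2 ^ 2 * phiSeries 0 2 := by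
    rw [e2, ← e3]; ring
  have e8 : eulerProduct 1 ^ 8 = (eulerProduct 2 ^ 2 * phiSeries 1 1 ^ 2) ^ 2 := by
    rw [← mul_pow, ← e1]; ring
  rw [e8, hO, e4]
  push_cast
  ring

end Vanishing

/-! ### Congruences modulo 5 and 25. -/

section Congruences

theorem theta23_five_mul_theta14 : theta23 5 * theta14 5 = eulerProduct 5 * eulerProduct 25 :=
  theta23_mul_theta14 (by norm_num)

/-- Reduces a congruence for class c of F to a polynomial one: after multiplication by N², a unit in
q^5, the other four components do not meet the class. -/
theorem dvdAtMod_five_of_quinticNorm {d : ℕ} {c : ℕ} (hc : c < 5) {Z : PowerSeries ℤ}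
    (h : (d : PowerSeries ℤ) ∣ eulerProduct 5 ^ 4 * quinticComponent (theta23 5) (theta14 5) c -
      Z * quinticNorm (theta23 5) (theta14 5) ^ 2) :
    DvdAtMod d 5 c (fiveRegularBipartitionSeries - X ^ c * Z) := by
  have hs : SupportedMod 5 0 (theta23 5) := supportedMod_theta23 (by norm_num) dvd_rfl
  have ht : SupportedMod 5 0 (theta14 5) := supportedMod_theta14 (by norm_num) dvd_rfl
  have hU : SupportedMod 5 0 (eulerProduct 5 ^ 4) :=
    (supportedMod_eulerProduct (by norm_num) dvd_rfl).pow 4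
  refine DvdAtMod.of_mul (U := quinticNorm (theta23 5) (theta14 5) ^ 2) ?_
    ((supportedMod_quinticNorm hs ht).pow 2)
    (by rw [map_pow, constantCoeff_quinticNorm_theta, one_pow])
  rw [sub_mul, mul_quinticNorm_sq fiveRegularBipartitionSeries_mul_eulerProduct
    eulerProduct_one_mul_five, ← Finset.add_sum_erase _ _ (Finset.mem_range.2 hc)]
  have h1 : DvdAtMod d 5 c (∑ i ∈ (Finset.range 5).erase c,
      eulerProduct 5 ^ 4 * (X ^ i * quinticComponent (theta23 5) (theta14 5) i)) := by
    intro n hn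
    rw [map_sum]
    refine Finset.dvd_sum fun i hi => ?_
    obtain ⟨hi1, hi2⟩ := Finset.mem_erase.1 hi
    have hi3 := Finset.mem_range.1 hi2
    exact (supportedMod_quinticComponent hs ht i).dvdAtMod_X_pow_mul hU (by omega) n hn
  convert h1.add (dvdAtMod_of_dvd (m := 5) (r := c) (h.mul_left (X ^ c))) using 1
  ring

theorem five_dvd_B5 {c n : ℕ} (hc : 2 ≤ c) (hc' : c < 5) (hn : n % 5 = c) : (5 : ℤ) ∣ B5 n := by
  have : DvdAtMod (5 : ℕ) 5 c (fiveRegularBipartitionSeries - X ^ c * 0) := by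
    refine dvdAtMod_five_of_quinticNorm hc' ?_
    rw [zero_mul, sub_zero]
    refine Dvd.dvd.mul_left ?_ _
    generalize theta23 5 = s
    generalize theta14 5 = t
    obtain rfl | rfl | rfl : c = 2 ∨ c = 3 ∨ c = 4 := by omega
    · exact ⟨s ^ 14 * t ^ 2 + 4 * X ^ 5 * s ^ 9 * t ^ 7 + 4 * X ^ 10 * s ^ 4 * t ^ 12, by
        simp only [quinticComponent]; push_cast; ring⟩
    · exact ⟨2 * s ^ 13 * t ^ 3 + 3 * X ^ 5 * s ^ 8 * t ^ 8 - 2 * X ^ 10 * s ^ 3 * t ^ 13, by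
        simp only [quinticComponent]; push_cast; ring⟩
    · exact ⟨4 * s ^ 12 * t ^ 4 - 4 * X ^ 5 * s ^ 7 * t ^ 9 + X ^ 10 * s ^ 2 * t ^ 14, by
        simp only [quinticComponent]; push_cast; ring⟩
  rw [mul_zero, sub_zero] at this
  exact this n (by omega)

theorem five_dvd_quinticNorm_theta_sub :
    ((5 : ℕ) : PowerSeries ℤ) ∣ quinticNorm (theta23 5) (theta14 5) - eulerProduct 5 ^ 6 :=
  five_dvd_quinticNorm_sub eulerProduct_one_mul_five
    (by simpa using five_dvd_eulerProduct_pow_sub (k := 1) one_pos)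

/-- Since -11 ≡ 4 and -1 ≡ 4 modulo 5, component 2 is 5 S⁴T² N modulo 25. Dividing by N² and using N
≡ f_5^6 and ST = f_5 f_25 leaves 5 f_25² S². -/
theorem twentyFive_dvd_two : DvdAtMod (25 : ℕ) 5 2 (fiveRegularBipartitionSeries -
    X ^ 2 * (5 * (eulerProduct 25 ^ 2 * theta23 5 ^ 2))) := by
  refine dvdAtMod_five_of_quinticNorm (by norm_num) ?_
  obtain ⟨Z, hZ⟩ := five_dvd_quinticNorm_theta_sub
  have hst := theta23_five_mul_theta14
  have hN : quinticNorm (theta23 5) (theta14 5) = _ := rfl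
  conv_rhs at hN => rw [quinticNorm]
  push_cast at hZ ⊢
  simp only [quinticComponent]
  generalize quinticNorm (theta23 5) (theta14 5) = N at *
  generalize theta23 5 = s at *
  generalize theta14 5 = t at *
  generalize eulerProduct 5 = f at *
  generalize eulerProduct 25 = g at *
  refine ⟨f ^ 4 * s ^ 4 * t ^ 2 * (3 * X ^ 5 * s ^ 5 * t ^ 5 + X ^ 10 * t ^ 10) -
    s ^ 2 * g ^ 2 * N * Z, ?_⟩
  linear_combination (-5 * f ^ 4 * s ^ 4 * t ^ 2) * hN +
    5 * f ^ 4 * s ^ 2 * N * (s * t + f * g) * hst - 5 * s ^ 2 * g ^ 2 * N * hZ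

/-- As for class 2, with component 4 equal to -5 S²T⁴ N modulo 25. -/
theorem twentyFive_dvd_four : DvdAtMod (25 : ℕ) 5 4 (fiveRegularBipartitionSeries -
    X ^ 4 * (-5 * (eulerProduct 25 ^ 2 * theta14 5 ^ 2))) := by
  refine dvdAtMod_five_of_quinticNorm (by norm_num) ?_
  obtain ⟨Z, hZ⟩ := five_dvd_quinticNorm_theta_sub
  have hst := theta23_five_mul_theta14
  have hN : quinticNorm (theta23 5) (theta14 5) = _ := rfl
  conv_rhs at hN => rw [quinticNorm]
  push_cast at hZ ⊢
  simp only [quinticComponent]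
  generalize quinticNorm (theta23 5) (theta14 5) = N at *
  generalize theta23 5 = s at *
  generalize theta14 5 = t at *
  generalize eulerProduct 5 = f at *
  generalize eulerProduct 25 = g at *
  refine ⟨f ^ 4 * s ^ 2 * t ^ 4 * (s ^ 10 - 3 * X ^ 5 * s ^ 5 * t ^ 5) +
    t ^ 2 * g ^ 2 * N * Z, ?_⟩
  linear_combination (5 * f ^ 4 * s ^ 2 * t ^ 4) * hN -
    5 * f ^ 4 * t ^ 2 * N * (s * t + f * g) * hst + 5 * t ^ 2 * g ^ 2 * N * hZ

theorem twentyFive_dvd_B5 {n : ℕ} (h : n % 20 = 7 ∨ n % 20 = 19) : (25 : ℤ) ∣ B5 n := by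
  rcases h with h | h
  · have h1 := twentyFive_dvd_two n (by omega)
    obtain ⟨k, rfl⟩ : ∃ k, n = k + 2 := ⟨n - 2, by omega⟩
    have h2 := coeff_eulerProduct_sq_mul_theta23_sq k (by omega)
    rw [zero_dvd_iff] at h2
    have h5 : (5 : PowerSeries ℤ) = C 5 := by simp
    rw [map_sub, coeff_X_pow_mul, h5, coeff_C_mul, h2, mul_zero, sub_zero] at h1
    exact h1
  · have h1 := twentyFive_dvd_four n (by omega)
    obtain ⟨k, rfl⟩ : ∃ k, n = k + 4 := ⟨n - 4, by omega⟩
    have h2 := coeff_eulerProduct_sq_mul_theta14_sq k (by omega)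
    rw [zero_dvd_iff] at h2
    have h5 : (-5 : PowerSeries ℤ) = C (-5) := by simp
    rw [map_sub, coeff_X_pow_mul, h5, coeff_C_mul, h2, mul_zero, sub_zero] at h1
    exact h1

theorem five_dvd_B5_of_mod_four {n : ℕ} (h : n % 4 = 3) : (5 : ℤ) ∣ B5 n := by
  obtain ⟨V, hV⟩ := five_dvd_eulerProduct_pow_sub (k := 1) one_pos
  have hF := fiveRegularBipartitionSeries_mul_eulerProduct
  have hd : ((5 : ℕ) : PowerSeries ℤ) ∣ fiveRegularBipartitionSeries - eulerProduct 1 ^ 8 := by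
    refine natCast_dvd_of_mul (U := eulerProduct 1 ^ 2) ?_
      (by rw [map_pow, constantCoeff_eulerProduct one_pos, one_pow])
    rw [mul_one] at hV
    exact ⟨-(V * (eulerProduct 5 + eulerProduct 1 ^ 5)), by
      linear_combination hF - (eulerProduct 5 + eulerProduct 1 ^ 5) * hV⟩
  have h1 := natCast_dvd_iff_coeff.1 hd n
  rw [map_sub, zero_dvd_iff.1 (coeff_eulerProduct_pow_eight n h), sub_zero] at h1
  exact h1

/-! ### Congruences modulo 2 and 4. -/

theorem two_dvd_B5_of_odd {n : ℕ} (h : n % 2 = 1) : (2 : ℤ) ∣ B5 n := by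
  obtain ⟨V, hV⟩ := two_dvd_eulerProduct_sq_sub (k := 1) one_pos
  obtain ⟨W, hW⟩ := two_dvd_eulerProduct_sq_sub (k := 5) (by norm_num)
  have hF := fiveRegularBipartitionSeries_mul_eulerProduct
  norm_num at hV hW
  -- F f_2 ≡ F f_1² = f_5² ≡ f_10 modulo 2, which has only even exponents.
  have hd : DvdAtMod 2 2 1 (fiveRegularBipartitionSeries * eulerProduct 2) := by
    have h1 : SupportedMod 2 0 (eulerProduct 10) :=
      supportedMod_eulerProduct (by norm_num) (by norm_num)
    have h2 : ((2 : ℕ) : PowerSeries ℤ) ∣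
        ((2 : ℕ) : PowerSeries ℤ) * (W - fiveRegularBipartitionSeries * V) := dvd_mul_right _ _
    convert (h1.dvdAtMod (d := 2) (m' := 2) (r' := 1) dvd_rfl (by norm_num)).add
      (dvdAtMod_of_dvd (m := 2) (r := 1) h2) using 1
    push_cast
    linear_combination hF - fiveRegularBipartitionSeries * hV + hW
  exact hd.of_mul (supportedMod_eulerProduct two_pos dvd_rfl)
    (constantCoeff_eulerProduct two_pos) n h

/-- The difference between `f_k f_{5k}` and its 2-dissection modulo `2`. -/
noncomputable def dissectionDefect (k : ℕ) : PowerSeries ℤ :=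
  eulerProduct k * eulerProduct (5 * k) - (psiSeries (2 * k) + X ^ k * psiSeries (10 * k))

/-- Modulo 2, the squares in the dissection of f_k f_{5k} match the first two terms of the
quintisection of ψ(q^(2k)). What is left is q^k times the defect at 5k. -/
theorem dissectionDefect_step {k : ℕ} (hk : 0 < k) : ((2 : ℕ) : PowerSeries ℤ) ∣
    dissectionDefect k - X ^ k * dissectionDefect (5 * k) := by
  obtain ⟨A, hA⟩ := two_dvd_thetaSeries_one_sq_sub (r := 15 * k) (s := 10 * k) (by positivity)
    (by positivity)
  obtain ⟨B, hB⟩ := two_dvd_thetaSeries_one_sq_sub (r := 20 * k) (s := 5 * k) (by positivity)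
    (by positivity)
  have hD := eulerProduct_mul_five hk
  have hst := theta23_mul_theta14 (k := 5 * k) (by omega)
  have hpsi := psiSeries_quintisection hk
  have e1 : theta23 (5 * k) = thetaSeries 1 (15 * k) (10 * k) := by
    rw [theta23]; congr 1 <;> push_cast <;> ring
  have e2 : theta14 (5 * k) = thetaSeries 1 (20 * k) (5 * k) := by
    rw [theta14]; congr 1; push_cast; ring
  rw [← e1] at hA
  rw [← e2] at hB
  unfold dissectionDefect
  rw [show 2 * (5 * k) = 10 * k by ring, show 10 * (5 * k) = 50 * k by ring]
  refine ⟨A - X ^ (2 * k) * B - X ^ (2 * k) * thetaDouble (20 * k) (5 * k) -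
    X ^ k * eulerProduct (5 * k) * eulerProduct (5 * (5 * k)), ?_⟩
  push_cast at hA hB ⊢
  linear_combination hD - X ^ k * hst + hA - X ^ (2 * k) * hB - hpsi

/-- Each iteration gains at least one factor q, so modulo 2 the defect is divisible by every power
of q. -/
theorem two_dvd_dissectionDefect {k : ℕ} (hk : 0 < k) :
    ((2 : ℕ) : PowerSeries ℤ) ∣ dissectionDefect k := by
  have h : ∀ j k : ℕ, 0 < k → ∃ Y, ((2 : ℕ) : PowerSeries ℤ) ∣ dissectionDefect k - X ^ j * Y := by
    intro j
    induction j with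
    | zero => exact fun k _ => ⟨dissectionDefect k, by simp⟩
    | succ j ih =>
      intro k hk
      obtain ⟨Y, V, hV⟩ := ih (5 * k) (by omega)
      obtain ⟨W, hW⟩ := dissectionDefect_step hk
      obtain ⟨l, rfl⟩ : ∃ l, k = l + 1 := ⟨k - 1, by omega⟩
      exact ⟨X ^ l * Y, W + X ^ (l + 1) * V, by linear_combination hW + X ^ (l + 1) * hV⟩
  rw [natCast_dvd_iff_coeff]
  intro n
  obtain ⟨Y, hY⟩ := h (n + 1) k hk
  have h1 := natCast_dvd_iff_coeff.1 hY n
  rwa [map_sub, coeff_X_pow_mul', if_neg (by omega), sub_zero] at h1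

/-- A congruence modulo 2 squares to one modulo 4: F f_1⁴ = (f_1 f_5)² becomes F f_2² ≡ (ψ(q²) +
qψ(q^10))². Its odd part is 2qψ(q²)ψ(q^10), and ψ(q²) ≡ f_2³ modulo 2. -/
theorem four_dvd_odd_part : DvdAtMod 4 2 1
    (fiveRegularBipartitionSeries - 2 * (X * (eulerProduct 2 * psiSeries 10))) := by
  obtain ⟨H, hH⟩ := two_dvd_dissectionDefect one_pos
  obtain ⟨V, hV⟩ := two_dvd_eulerProduct_sq_sub (k := 1) one_pos
  obtain ⟨W, hW⟩ := two_dvd_eulerProduct_sq_sub (k := 2) two_pos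
  have hF := fiveRegularBipartitionSeries_mul_eulerProduct
  have hpsi := eulerProduct_mul_psiSeries (k := 2) two_pos
  have h3 : ((2 : ℕ) : PowerSeries ℤ) ∣ psiSeries 2 - eulerProduct 2 ^ 3 := by
    refine natCast_dvd_of_mul (U := eulerProduct 2) ?_ (constantCoeff_eulerProduct two_pos)
    exact ⟨-(W * (eulerProduct 4 + eulerProduct 2 ^ 2)), by
      norm_num at hW hpsi ⊢
      linear_combination hpsi - (eulerProduct 4 + eulerProduct 2 ^ 2) * hW⟩
  obtain ⟨Y, hY⟩ := h3
  rw [dissectionDefect] at hH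
  norm_num at hH hV hY
  have hp2 : SupportedMod 2 0 (psiSeries 2) :=
    supportedMod_thetaSeries 0 (by norm_num) (by norm_num) (by norm_num) (by norm_num)
  have hp10 : SupportedMod 2 0 (psiSeries 10) :=
    supportedMod_thetaSeries 0 (by norm_num) (by norm_num) (by norm_num) (by norm_num)
  have hsq : SupportedMod 2 0 (psiSeries 2 ^ 2 + X ^ 2 * psiSeries 10 ^ 2) :=
    (hp2.pow 2).add (((supportedMod_X_pow 2 2).mul (hp10.pow 2)).congr (by norm_num))
  refine DvdAtMod.of_mul (U := eulerProduct 2 ^ 2) ?_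
    ((supportedMod_eulerProduct two_pos dvd_rfl).pow 2)
    (by rw [map_pow, constantCoeff_eulerProduct two_pos, one_pow])
  have h4 : ((4 : ℕ) : PowerSeries ℤ) ∣ ((4 : ℕ) : PowerSeries ℤ) *
      (X * Y * psiSeries 10 + H * (psiSeries 2 + X * psiSeries 10) + H ^ 2 -
        fiveRegularBipartitionSeries * (V * eulerProduct 2 + V ^ 2)) := dvd_mul_right _ _
  convert (hsq.dvdAtMod (d := 4) (m' := 2) (r' := 1) dvd_rfl (by norm_num)).add
    (dvdAtMod_of_dvd (m := 2) (r := 1) h4) using 1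
  push_cast
  linear_combination eulerProduct 1 ^ 2 * hF - fiveRegularBipartitionSeries *
      (eulerProduct 1 ^ 2 + eulerProduct 2 + 2 * V) * hV +
    (eulerProduct 1 * eulerProduct 5 + psiSeries 2 + X * psiSeries 10 + 2 * H) * hH +
    2 * X * psiSeries 10 * hY

/-- Multiplied by f_10, the product is ψ(q^10) times the dissection of f_2 f_10, whose exponents are
0, 2, 4 modulo 5. -/
theorem coeff_eulerProduct_two_mul_psiSeries {c : ℕ} (hc : c % 5 = 1 ∨ c % 5 = 3) :
    DvdAtMod 0 5 c (eulerProduct 2 * psiSeries 10) := by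
  refine DvdAtMod.of_mul (U := eulerProduct 10) ?_
    (supportedMod_eulerProduct (by norm_num) (by norm_num))
    (constantCoeff_eulerProduct (by norm_num))
  have hs : SupportedMod 5 0 (theta23 10) := supportedMod_theta23 (by norm_num) (by norm_num)
  have ht : SupportedMod 5 0 (theta14 10) := supportedMod_theta14 (by norm_num) (by norm_num)
  have hp : SupportedMod 5 0 (psiSeries 10) :=
    supportedMod_thetaSeries 0 (by norm_num) (by norm_num) (by norm_num) (by norm_num)
  have hD := eulerProduct_mul_five (k := 2) two_pos
  norm_num at hD
  have h0 := ((hs.pow 2).dvdAtMod_X_pow_mul (r := 0) (r' := c) (d := 0) hp (by omega)).sub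
    ((hs.mul ht).dvdAtMod_X_pow_mul (r := 2) (r' := c) (d := 0) hp (by omega)) |>.sub
    ((ht.pow 2).dvdAtMod_X_pow_mul (r := 4) (r' := c) (d := 0) hp (by omega))
  convert h0 using 1
  linear_combination psiSeries 10 * hD

theorem four_dvd_B5 {n : ℕ} (h : n % 20 = 7 ∨ n % 20 = 19) : (4 : ℤ) ∣ B5 n := by
  have h1 := four_dvd_odd_part n (by omega)
  obtain ⟨k, rfl⟩ : ∃ k, n = k + 1 := ⟨n - 1, by omega⟩
  have h2 := coeff_eulerProduct_two_mul_psiSeries (c := k) (by omega) k rfl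
  rw [zero_dvd_iff] at h2
  have h5 : (2 : PowerSeries ℤ) = C 2 := by simp
  rw [map_sub, h5, coeff_C_mul, coeff_succ_X_mul, h2, mul_zero, sub_zero] at h1
  exact h1

theorem hundred_dvd_B5 {n : ℕ} (h : n % 20 = 7 ∨ n % 20 = 19) : (100 : ℤ) ∣ B5 n := by
  have h1 := twentyFive_dvd_B5 h
  have h2 := four_dvd_B5 h
  omega

end Congruences

theorem mainTheorem6 :
    (∀ n : ℕ, B5 (4 * n + 3) ≡ 0 [ZMOD 10]) ∧
    (∀ n : ℕ, B5 (5 * n + 2) ≡ 0 [ZMOD 5] ∧ B5 (5 * n + 3) ≡ 0 [ZMOD 5] ∧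
      B5 (5 * n + 4) ≡ 0 [ZMOD 5]) ∧
    (∀ n : ℕ, B5 (20 * n + 7) ≡ 0 [ZMOD 100] ∧ B5 (20 * n + 19) ≡ 0 [ZMOD 100]) := by
  simp only [Int.modEq_zero_iff_dvd]
  refine ⟨fun n => ?_, fun n => ⟨?_, ?_, ?_⟩, fun n => ⟨?_, ?_⟩⟩
  · have h1 := five_dvd_B5_of_mod_four (n := 4 * n + 3) (by omega)
    have h2 := two_dvd_B5_of_odd (n := 4 * n + 3) (by omega)
    omega
  · exact five_dvd_B5 (c := 2) le_rfl (by norm_num) (by omega)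
  · exact five_dvd_B5 (c := 3) (by norm_num) (by norm_num) (by omega)
  · exact five_dvd_B5 (c := 4) (by norm_num) (by norm_num) (by omega)
  · exact hundred_dvd_B5 (by omega)
  · exact hundred_dvd_B5 (by omega)
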